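/- Let $\mathbb K$ be a commutative ring and let $A$ be a commutative Frobenius algebra over $\mathbb K$, that is, a commutative $\mathbb K$-algebra with a coassociative comultiplication $\Delta : A \to A \otimes_{\mathbb K} A$ and a counit $\varepsilon : A \to \mathbb K$ such that $\Delta$ is a map of $A$-bimodules. For an invertible element $\theta \in A$, let $A^\theta$ be the twist of $A$ by $\theta$: the Frobenius algebra with the same underlying algebra and with $$\varepsilon^\theta(x) = \varepsilon(\theta x), \qquad \Delta^\theta(x) = \Delta(\theta^{-1} x).$$ Let $D$ be an unoriented link diagram in the plane, given by its planar diagram code (a four-valent plane graph with over/under information at each vertex, together with finitely many components without crossings), with set of crossings $\mathcal X(D)$. For a state $S \subset \mathcal X(D)$ let $D_S$ be the smoothing of $D$ in which each crossing $c \notin S$ is replaced by its $0$-smoothing (merging the two regions swept out when the over-strand is rotated counterclockwise) and each $c \in S$ by its $1$-smoothing, and let $\pi_0(D_S)$ be the set of circles of $D_S$. Define $V_{D;A}(S) = \bigotimes_{C \in \pi_0(D_S)} A_C$, where $A_C$ is a copy of $A$ and the tensor products are over $\mathbb K$. For $c \in \mathcal X(D) \setminus S$, define $\xi_c^S : V_{D;A}(S)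 \to V_{D;A}(S \cup \{c\})$ to consist of $\Delta : A_C \to A_{C_1'} \otimes A_{C_2'}$ if $c$ splits $C$ into $C_1'$ and $C_2'$, of the multiplication $A_{C_1} \otimes A_{C_2} \to A_{C'}$ if $c$ merges $C_1$ and $C_2$ into $C'$, and of the identity on $A_C$ for each circle $C$ apart from $c$. Then the families $V_{D;A}$ and $V_{D;A^\theta}$ are commutative $\mathcal X(D)$-cubes of $\mathbb K$-modules, that is, $\xi_b \xi_a = \xi_a \xi_b$ for all $S$ and all distinct $a, b \in \mathcal X(D) \setminus S$, and they are isomorphic as cubes: there are $\mathbb K$-linear isomorphisms $V_{D;A^\theta}(S) \cong V_{D;A}(S)$, for $S \subset \mathcal X(D)$, which commute with all the $\xi_c^S$. In particular, for every choice of signs $\sigma(S, c) \in \{\pm 1\}$ ($c \notin S$) that makes each square of the cube anticommute, $\sigma(S,a)\,\sigma(S \cup \{a\}, b) = -\sigma(S,b)\,\sigma(S \cup \{b\}, a)$, the complexes $C(D;A^\theta)$ and $C(D;A)$, where $C^i(D;A) = \bigoplus_{|S| = i} V_{D;A}(S)$ with differential $d = \sum \sigma(S,c)\, \xi_c^S$,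 are isomorphic as complexes of $\mathbb K$-modules. -/

import Mathlib

open CategoryTheory CategoryTheory.Limits
open scoped TensorProduct

/-! ### Commutative Frobenius algebras and their twists -/

/-- A Frobenius algebra structure on a commutative `K`-algebra `A`: a coassociative counital
coalgebra structure (Mathlib's `Coalgebra`) whose comultiplication is a map of `A`-bimodules.
(For commutative `A` cocommutativity is a consequence.) -/
structure FrobeniusStructure (K A : Type*) [CommRing K] [CommRing A] [Algebra K A]
    extends Coalgebra K A where
  comul_mul_left : ∀ a b : A, comul (a * b) = (a ⊗ₜ[K] (1 : A)) * comul b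
  comul_mul_right : ∀ a b : A, comul (a * b) = comul a * ((1 : A) ⊗ₜ[K] b)

namespace FrobeniusStructure

variable {K A : Type*} [CommRing K] [CommRing A] [Algebra K A]

theorem rTensor_mulLeft (F : FrobeniusStructure K A) (u y : A) :
    (LinearMap.mulLeft K u).rTensor A (F.comul y) = F.comul (u * y) := by
  rw [F.comul_mul_left]
  induction F.comul y using TensorProduct.induction_on with
  | zero => simp
  | tmul a b => simp
  | add a b ha hb => rw [map_add, ha, hb, mul_add]

theorem lTensor_mulLeft (F : FrobeniusStructure K A) (u y : A) :
    (LinearMap.mulLeft K u).lTensor A (F.comul y) = F.comul (u * y) := by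
  rw [mul_comm u y, F.comul_mul_right]
  induction F.comul y using TensorProduct.induction_on with
  | zero => simp
  | tmul a b => simp [mul_comm]
  | add a b ha hb => rw [map_add, ha, hb, add_mul]

/-- The twist `A^θ`: the same algebra, with `ε^θ(x) = ε(θ x)` and `Δ^θ(x) = Δ(θ⁻¹ x)`. -/
def twist (F : FrobeniusStructure K A) (θ : Aˣ) : FrobeniusStructure K A where
  counit := F.counit ∘ₗ LinearMap.mulLeft K (θ : A)
  comul := F.comul ∘ₗ LinearMap.mulLeft K ((θ⁻¹ : Aˣ) : A)
  coassoc := by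
    ext x
    simp [LinearMap.rTensor_comp, LinearMap.lTensor_comp, rTensor_mulLeft, lTensor_mulLeft]
  rTensor_counit_comp_comul := by
    ext x
    simp [LinearMap.rTensor_comp, rTensor_mulLeft]
  lTensor_counit_comp_comul := by
    ext x
    simp [LinearMap.lTensor_comp, lTensor_mulLeft]
  comul_mul_left a b := by
    have := F.comul_mul_left a (((θ⁻¹ : Aˣ) : A) * b)
    simpa [mul_left_comm] using this
  comul_mul_right a b := by
    have := F.comul_mul_right (((θ⁻¹ : Aˣ) : A) * a) b
    simpa [mul_assoc] using this

end FrobeniusStructure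

/-! ### Link diagrams -/

/-- An unoriented link diagram in the plane, given by its planar diagram code: a four-valent plane
graph, encoded by its rotation system, with over/under information at each vertex, together with
a finite number of components without crossings.

At each crossing `c` the four ends `(c, 0), (c, 1), (c, 2), (c, 3)` are listed counterclockwise,
in such a way that the under-strand joins `(c, 0)` to `(c, 2)` and the over-strand joins `(c, 1)`
to `(c, 3)`.  The involution `edge` matches the two ends of each edge of the diagram.  The last
field is Euler's formula `V - E + F = 2 k`, with `k` the number of connected components of the
four-valent graph: it says that each component has genus `0`, that is, is drawn in the plane. -/
structure LinkDiagram where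
  Crossing : Type
  [fintypeCrossing : Fintype Crossing]
  [decidableEqCrossing : DecidableEq Crossing]
  edge : Crossing × Fin 4 → Crossing × Fin 4
  edge_edge : ∀ x, edge (edge x) = x
  edge_ne : ∀ x, edge x ≠ x
  /-- the number of components without crossings -/
  free : ℕ
  euler :
    Nat.card Crossing
      -- the faces: follow an edge, then turn to the next end around the crossing reached
      + Nat.card (Quot fun x y : Crossing × Fin 4 => y = ((edge x).1, (edge x).2 + 1))
    -- the edges
    = Nat.card (Quot fun x y : Crossing × Fin 4 => y = edge x)
      -- the connected components
      + 2 * Nat.card (Quot fun x y : Crossing × Fin 4 => y = edge x ∨ y = (x.1, x.2 + 1))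

namespace LinkDiagram

attribute [instance] fintypeCrossing decidableEqCrossing

variable (D : LinkDiagram)

/-- The ends of edges at crossings, and one point on each component without crossings. -/
abbrev Point : Type := (D.Crossing × Fin 4) ⊕ Fin D.free

/-- The end joined to a given end by an arc of the smoothing of its crossing in the state `S`:
for `c ∉ S` the arcs at `c` join `0` with `1` and `2` with `3` (the regions swept by rotating the
over-strand counterclockwise are merged), and for `c ∈ S` they join `1` with `2` and `3` with `0`. -/
def smooth (S : Finset D.Crossing) (x : D.Crossing × Fin 4) : D.Crossing × Fin 4 :=
  (x.1, if x.1 ∈ S then ![3, 2, 1, 0] x.2 else ![1, 0, 3, 2] x.2)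

/-- Two points of the smoothing `D_S` which are joined by an edge of `D` or by an arc in the
smoothing of a crossing. -/
inductive Adj (S : Finset D.Crossing) : D.Point → D.Point → Prop
  | edge (x : D.Crossing × Fin 4) : Adj S (Sum.inl x) (Sum.inl (D.edge x))
  | smooth (x : D.Crossing × Fin 4) : Adj S (Sum.inl x) (Sum.inl (D.smooth S x))

/-- `π₀(D_S)`, the set of circles of the smoothing `D_S`. -/
def Circle (S : Finset D.Crossing) : Type := Quot (D.Adj S)

/-- The circle of `D_S` through a given point. -/
def circle (S : Finset D.Crossing) (x : D.Point) : D.Circle S := Quot.mk _ x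

instance (S : Finset D.Crossing) : Finite (D.Circle S) :=
  inferInstanceAs (Finite (Quot (D.Adj S)))

noncomputable instance (S : Finset D.Crossing) : Fintype (D.Circle S) := Fintype.ofFinite _

noncomputable instance (S : Finset D.Crossing) : DecidableEq (D.Circle S) := Classical.decEq _

/-- The circles of `D_S` adjacent to the crossing `c`: in every state, one of the two arcs at `c`
ends at `(c, 0)`, and the other one at `(c, 2)`. -/
def side₀ (S : Finset D.Crossing) (c : D.Crossing) : D.Circle S := D.circle S (Sum.inl (c, 0))

/-- See `side₀`. -/
def side₂ (S : Finset D.Crossing) (c : D.Crossing) : D.Circle S := D.circle S (Sum.inl (c, 2))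

/-- The circle of `D_T` through a point of the circle `C` of `D_S`. It is used when `T` is
`S ∪ {c}` and `C` is apart from `c`: then it is the circle of `D_T` identified with `C`, whichever
point of `C` is taken (`circle_eq_corr`). -/
noncomputable def corr {S : Finset D.Crossing} (T : Finset D.Crossing) (C : D.Circle S) :
    D.Circle T :=
  D.circle T (Quot.out C)

theorem circle_eq_corr (S : Finset D.Crossing) (c : D.Crossing) (x : D.Point)
    (h₀ : D.circle S x ≠ D.side₀ S c) (h₂ : D.circle S x ≠ D.side₂ S c) :
    D.circle (insert c S) x = D.corr (insert c S) (D.circle S x) := by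
  have h₁ : D.circle S (Sum.inl (c, 1)) = D.side₀ S c ∨
      D.circle S (Sum.inl (c, 1)) = D.side₂ S c := by
    have h : D.circle S (Sum.inl (c, 1)) = _ := Quot.sound (Adj.smooth (c, 1))
    by_cases hc : c ∈ S
    · right; simp only [LinkDiagram.smooth, hc] at h; exact h
    · left; simp only [LinkDiagram.smooth, hc] at h; exact h
  have h₃ : D.circle S (Sum.inl (c, 3)) = D.side₀ S c ∨
      D.circle S (Sum.inl (c, 3)) = D.side₂ S c := by
    have h : D.circle S (Sum.inl (c, 3)) = _ := Quot.sound (Adj.smooth (c, 3))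
    by_cases hc : c ∈ S
    · left; simp only [LinkDiagram.smooth, hc] at h; exact h
    · right; simp only [LinkDiagram.smooth, hc] at h; exact h
  have key : ∀ y z, Relation.EqvGen (D.Adj S) y z →
      D.circle S y ≠ D.side₀ S c → D.circle S y ≠ D.side₂ S c →
      D.circle (insert c S) y = D.circle (insert c S) z := by
    intro y z h
    induction h with
    | refl => intros; rfl
    | symm a b hab ih =>
      intro ha hb
      have e : D.circle S a = D.circle S b := Quot.eqvGen_sound hab
      exact (ih (e ▸ ha) (e ▸ hb)).symm
    | trans a b d hab _ ih₁ ih₂ =>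
      intro ha hb
      have e : D.circle S a = D.circle S b := Quot.eqvGen_sound hab
      exact (ih₁ ha hb).trans (ih₂ (e ▸ ha) (e ▸ hb))
    | rel a b hab =>
      intro ha hb
      cases hab with
      | edge x => exact Quot.sound (Adj.edge x)
      | smooth x =>
        have hx : x.1 ≠ c := by
          rintro rfl
          obtain ⟨c, i⟩ := x
          fin_cases i
          · exact ha rfl
          · exact h₁.elim ha hb
          · exact hb rfl
          · exact h₃.elim ha hb
        have hs : D.smooth S x = D.smooth (insert c S) x := by
          simp [LinkDiagram.smooth, hx]
        rw [hs]
        exact Quot.sound (Adj.smooth x)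
  exact key _ _ (Quot.eqvGen_exact (Quot.out_eq (D.circle S x)).symm) h₀ h₂

end LinkDiagram

/-! ### Cubes and their complexes -/

/-- A family of objects `V(S)`, for `S ⊆ Λ`, with morphisms `ξ_c^S : V(S) ⟶ V(S ∪ {c})` for
`c ∉ S` (the target is written as `V(T)` with `T = S ∪ {c}`). -/
structure Cube (Λ : Type*) [DecidableEq Λ] (𝒞 : Type*) [Category 𝒞] where
  obj : Finset Λ → 𝒞
  map : ∀ {S T : Finset Λ} (c : Λ), c ∉ S → insert c S = T → (obj S ⟶ obj T)

namespace Cube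

variable {Λ : Type*} [DecidableEq Λ] {𝒞 : Type*} [Category 𝒞]

/-- The cube is commutative: `ξ_b ξ_a = ξ_a ξ_b`. -/
def IsCommutative (V : Cube Λ 𝒞) : Prop :=
  ∀ {S Ta Tb U : Finset Λ} (a b : Λ) (ha : a ∉ S) (hb : b ∉ S)
    (hTa : insert a S = Ta) (hTb : insert b S = Tb) (hb' : b ∉ Ta) (ha' : a ∉ Tb)
    (hU : insert b Ta = U) (hU' : insert a Tb = U),
    V.map a ha hTa ≫ V.map b hb' hU = V.map b hb hTb ≫ V.map a ha' hU'

/-- An isomorphism of cubes. -/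
structure Iso (V W : Cube Λ 𝒞) where
  app : ∀ S : Finset Λ, V.obj S ≅ W.obj S
  naturality : ∀ {S T : Finset Λ} (c : Λ) (hc : c ∉ S) (hT : insert c S = T),
    V.map c hc hT ≫ (app T).hom = (app S).hom ≫ W.map c hc hT

end Cube

/-- A choice of signs for the edges `S → S ∪ {c}` of the `Λ`-cube, such that each square
anticommutes. -/
structure SignAssignment (Λ : Type*) [DecidableEq Λ] where
  sign : Finset Λ → Λ → ℤˣ
  anticomm : ∀ (S : Finset Λ) (a b : Λ), a ∉ S → b ∉ S → a ≠ b →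
    sign S a * sign (insert a S) b = - (sign S b * sign (insert b S) a)

/-- The usual signs `(-1)^{#{b ∈ S | b < c}}` for an ordering of `Λ`. -/
def SignAssignment.standard (Λ : Type*) [LinearOrder Λ] : SignAssignment Λ where
  sign S c := (-1) ^ (S.filter (· < c)).card
  anticomm S a b ha hb hab := by
    rcases lt_or_gt_of_ne hab with h | h
    · rw [Finset.filter_insert, Finset.filter_insert, if_pos h, if_neg h.le.not_gt,
        Finset.card_insert_of_notMem (by simp [ha]), pow_succ]
      simp [mul_comm]
    · rw [Finset.filter_insert, Finset.filter_insert, if_neg h.le.not_gt, if_pos h,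
        Finset.card_insert_of_notMem (by simp [hb]), pow_succ]
      simp [mul_comm]

namespace Cube

variable {Λ : Type*} [Fintype Λ] [DecidableEq Λ] {𝒞 : Type*} [Category 𝒞] [Preadditive 𝒞]
  [HasFiniteBiproducts 𝒞]

/-- `C_V^i = ⨁_{|S| = i} V(S)`. -/
noncomputable abbrev cochain (V : Cube Λ 𝒞) (i : ℕ) : 𝒞 :=
  ⨁ fun S : {S : Finset Λ // S.card = i} => V.obj S.1

/-- The differential `d = ∑ ± ξ_c`: its component at `T` is the sum over `c ∈ T` of the maps
`± ξ_c` from `V(T \ {c})`. -/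
noncomputable def diff (V : Cube Λ 𝒞) (s : SignAssignment Λ) (i : ℕ) :
    V.cochain i ⟶ V.cochain (i + 1) :=
  biproduct.lift fun T : {T : Finset Λ // T.card = i + 1} =>
    ∑ c : {c : Λ // c ∈ T.1},
      ((s.sign (T.1.erase c.1) c.1 : ℤˣ) : ℤ) •
        (biproduct.π (fun S : {S : Finset Λ // S.card = i} => V.obj S.1)
            ⟨T.1.erase c.1, by rw [Finset.card_erase_of_mem c.2, T.2, Nat.add_sub_cancel]⟩ ≫
          V.map c.1 (Finset.notMem_erase c.1 T.1) (Finset.insert_erase c.2))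

theorem diff_comp_diff (V : Cube Λ 𝒞) (hV : V.IsCommutative) (s : SignAssignment Λ) (i : ℕ) :
    V.diff s i ≫ V.diff s (i + 1) = 0 := by
  have comp : ∀ T : {T : Finset Λ // T.card = i + 1},
      V.diff s i ≫ biproduct.π (fun S : {S : Finset Λ // S.card = i + 1} => V.obj S.1) T =
        ∑ c : {c : Λ // c ∈ T.1}, ((s.sign (T.1.erase c.1) c.1 : ℤˣ) : ℤ) •
        (biproduct.π (fun S : {S : Finset Λ // S.card = i} => V.obj S.1)
            ⟨T.1.erase c.1, by rw [Finset.card_erase_of_mem c.2, T.2, Nat.add_sub_cancel]⟩ ≫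
          V.map c.1 (Finset.notMem_erase c.1 T.1) (Finset.insert_erase c.2)) := by
    intro T
    exact biproduct.lift_π _ T
  -- the two ways around a square, with opposite signs
  have square : ∀ (S S' : {S : Finset Λ // S.card = i}) (Ta Tb U : Finset Λ) (a b : Λ)
      (hSS' : S = S') (ha : a ∉ S.1) (hb : b ∉ S'.1) (hTa : insert a S.1 = Ta)
      (hTb : insert b S'.1 = Tb) (hb' : b ∉ Ta) (ha' : a ∉ Tb) (hU : insert b Ta = U)
      (hU' : insert a Tb = U),
      ((s.sign Ta b : ℤˣ) : ℤ) • ((s.sign S.1 a : ℤˣ) : ℤ) •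
          ((biproduct.π (fun S : {S : Finset Λ // S.card = i} => V.obj S.1) S ≫
            V.map a ha hTa) ≫ V.map b hb' hU) +
        ((s.sign Tb a : ℤˣ) : ℤ) • ((s.sign S'.1 b : ℤˣ) : ℤ) •
          ((biproduct.π (fun S : {S : Finset Λ // S.card = i} => V.obj S.1) S' ≫
            V.map b hb hTb) ≫ V.map a ha' hU') = 0 := by
    intro S S' Ta Tb U a b hSS' ha hb hTa hTb hb' ha' hU hU'
    subst hSS'
    have hab : a ≠ b := by
      rintro rfl
      exact hb' (hTa ▸ Finset.mem_insert_self _ _)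
    have hs := congrArg (fun u : ℤˣ => (u : ℤ)) (s.anticomm S.1 a b ha hb hab)
    simp only [Units.val_mul, Units.val_neg, hTa, hTb] at hs
    rw [Category.assoc, Category.assoc, hV a b ha hb hTa hTb hb' ha' hU hU', smul_smul, smul_smul,
      ← add_smul, mul_comm, hs, mul_comm, neg_add_eq_zero.mpr rfl, zero_smul]
  refine biproduct.hom_ext _ _ fun U => ?_
  rw [Category.assoc, zero_comp]
  have hd : V.diff s (i + 1) ≫
      biproduct.π (fun S : {S : Finset Λ // S.card = i + 1 + 1} => V.obj S.1) U = _ :=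
    biproduct.lift_π _ U
  rw [hd, Preadditive.comp_sum]
  simp only [Preadditive.comp_zsmul, ← Category.assoc, comp, Preadditive.sum_comp,
    Preadditive.zsmul_comp, Finset.smul_sum]
  rw [Finset.sum_sigma']
  refine Finset.sum_involution
    (fun p _ => ⟨⟨p.2.1, Finset.mem_of_mem_erase p.2.2⟩,
      ⟨p.1.1, Finset.mem_erase.mpr ⟨(Finset.ne_of_mem_erase p.2.2).symm, p.1.2⟩⟩⟩)
    ?_ ?_ ?_ ?_
  · rintro ⟨⟨c, hc⟩, ⟨b, hb⟩⟩ -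
    have hcb : c ≠ b := (Finset.ne_of_mem_erase hb).symm
    have hbU : b ∈ U.1 := Finset.mem_of_mem_erase hb
    have hc' : c ∈ U.1.erase b := Finset.mem_erase.mpr ⟨hcb, hc⟩
    exact square
      ⟨(U.1.erase c).erase b, by
        rw [Finset.card_erase_of_mem hb, Finset.card_erase_of_mem hc, U.2]; rfl⟩
      ⟨(U.1.erase b).erase c, by
        rw [Finset.card_erase_of_mem hc', Finset.card_erase_of_mem hbU, U.2]; rfl⟩
      (U.1.erase c) (U.1.erase b) U.1 b c (Subtype.ext Finset.erase_right_comm)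
      (Finset.notMem_erase _ _) (Finset.notMem_erase _ _) (Finset.insert_erase hb)
      (Finset.insert_erase hc') (Finset.notMem_erase _ _) (Finset.notMem_erase _ _)
      (Finset.insert_erase hc) (Finset.insert_erase hbU)
  · rintro ⟨⟨c, hc⟩, ⟨b, hb⟩⟩ - - h
    have : b = c := congrArg (fun p => p.1.1) h
    exact Finset.ne_of_mem_erase hb this
  · intros; exact Finset.mem_univ _
  · intros; rfl

/-- The complex `C_V` of a commutative cube. -/
noncomputable def complex (V : Cube Λ 𝒞) (hV : V.IsCommutative) (s : SignAssignment Λ) :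
    CochainComplex 𝒞 ℕ :=
  CochainComplex.of V.cochain (V.diff s) (V.diff_comp_diff hV s)

end Cube

/-! ### The cube of a link diagram -/

namespace LinkDiagram

variable {K A : Type*} [CommRing K] [CommRing A] [Algebra K A]

/-- `V_{D;A}(S)`, the tensor product over `K` of copies of `A` indexed by the circles of `D_S`. -/
abbrev StateModule (K A : Type*) [CommRing K] [CommRing A] [Algebra K A]
    (D : LinkDiagram) (S : Finset D.Crossing) : Type _ :=
  PiTensorProduct K fun _ : D.Circle S => A

/-- The inclusion `A_C → ⨂_C A_C` of a tensor factor (with `1` in the other factors). -/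
noncomputable def incl (K A : Type*) [CommRing K] [CommRing A] [Algebra K A]
    (D : LinkDiagram) {S : Finset D.Crossing} (C : D.Circle S) : A →ₐ[K] StateModule K A D S :=
  PiTensorProduct.singleAlgHom (R := K) (A := fun _ : D.Circle S => A) C

/-- The part of the structure morphism `ξ_c : V(S) → V(T)`, `T = S ∪ {c}`, on the factor `A_C`:
* if `c` splits `C`, then it is `Δ : A_C → A_{C'₁} ⊗ A_{C'₂}` for the two circles `C'₁`, `C'₂` of
  `D_T` adjacent to `c`;
* if `c` merges `C` with another circle, then it is the inclusion of the factor of the merged circle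
  (the product in the definition of `edgeMap` is then the multiplication);
* if `C` is apart from `c`, then it is the identity from `A_C` to the factor of the same circle. -/
noncomputable def circleMap (F : FrobeniusStructure K A) (D : LinkDiagram)
    (S T : Finset D.Crossing) (c : D.Crossing) (C : D.Circle S) : A →ₗ[K] StateModule K A D T :=
  if D.side₀ S c = D.side₂ S c ∧ C = D.side₀ S c then
    (Algebra.TensorProduct.lift (incl K A D (D.side₀ T c)) (incl K A D (D.side₂ T c))
      fun _ _ => Commute.all _ _).toLinearMap ∘ₗ F.comul
  else if C = D.side₀ S c ∨ C = D.side₂ S c then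
    (incl K A D (D.side₀ T c)).toLinearMap
  else
    (incl K A D (D.corr T C)).toLinearMap

/-- The structure morphism `ξ_c : V(S) → V(T)`, `T = S ∪ {c}`: it maps `⨂_C a_C` to the product of
the elements `circleMap C a_C` in the algebra `V(T) = ⨂_{C'} A_{C'}`. -/
noncomputable def edgeMap (F : FrobeniusStructure K A) (D : LinkDiagram)
    (S T : Finset D.Crossing) (c : D.Crossing) : StateModule K A D S →ₗ[K] StateModule K A D T :=
  PiTensorProduct.lift
    ((MultilinearMap.mkPiAlgebra K (D.Circle S) (StateModule K A D T)).compLinearMap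
      (circleMap F D S T c))

/-- The cube `V_{D;A}`. -/
noncomputable def cube (D : LinkDiagram) (F : FrobeniusStructure K A) :
    Cube D.Crossing (ModuleCat K) where
  obj S := ModuleCat.of K (StateModule K A D S)
  map {S T} c _ _ := ModuleCat.ofHom (edgeMap F D S T c)

end LinkDiagram

/-! The isomorphism at a state `S` is multiplication by a unit `stateUnit` of the algebra `V(S)`, a
product of powers of `θ` placed in the factors of circles. Every structure map is linear over the
copies of `A` attached to the points of the diagram (`pointLinear_edgeMap`), hence is determined by
its value at `1`: this is `1` for a merger and `Δ(1)`, placed in the two new factors, for a split.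
Both commutativity and compatibility with the units thus become identities between elements of
`V(T)`.

Planarity enters through homology. Euler's formula forces every mod 2 cycle of edges to bound a set
of faces (`range_faceCoboundary`), so it has a potential, a function of faces jumping across it. An
end doubles as a name for the face on one side of its edge. The cycle of all edges yields the
checkerboard colouring, which orients all state circles coherently, so that each crossing change is
a split or a merger (`side_insert_iff`). In a square of the cube the types of `a` and `b` either do
not depend on the order, or both change; in the second case the two composites insert the same
`Δ(1)`, because `Δ(1)` is symmetric.

The potential of a single circle tells which of its sides contains the base face. The index of a
circle is `1` if its neighbouring faces of colour `1` are on the side away from the base, and `0`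
otherwise. When two circles merge at `c`, their indices add up to the index of the result plus a
correction depending only on the colour at `c` and the smoothing there
(`AgreeOff.circleIndex_merge`). The unit combines `θ` to the index of each circle with a power of
`θ` at each `c ∈ S` which absorbs the correction: mergers then preserve the units, and each split
produces one surplus `θ`, cancelling the `θ⁻¹` in `Δ^θ`. -/

namespace LinkDiagram

variable (D : LinkDiagram)

/-! ### Homology of the plane modulo two -/

/-- The faces of the diagram. -/
abbrev Face : Type := Quot fun x y : D.Crossing × Fin 4 => y = ((D.edge x).1, (D.edge x).2 + 1)

/-- The edges of the diagram. -/
abbrev Edge : Type := Quot fun x y : D.Crossing × Fin 4 => y = D.edge x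

/-- The connected components of the underlying four-valent graph. -/
abbrev Component : Type :=
  Quot fun x y : D.Crossing × Fin 4 => y = D.edge x ∨ y = (x.1, x.2 + 1)

noncomputable instance : Fintype D.Face := Fintype.ofFinite _

noncomputable instance : Fintype D.Edge := Fintype.ofFinite _

noncomputable instance : Fintype D.Component := Fintype.ofFinite _

noncomputable instance : DecidableEq D.Edge := Classical.decEq _

/-- The component of the graph containing an end. -/
def comp (x : D.Crossing × Fin 4) : D.Component := Quot.mk _ x

/-- A chosen end in the component of an end. -/
noncomputable def base (x : D.Crossing × Fin 4) : D.Crossing × Fin 4 := Quot.out (D.comp x)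

theorem comp_edge (x : D.Crossing × Fin 4) : D.comp (D.edge x) = D.comp x :=
  (Quot.sound (r := fun x y : D.Crossing × Fin 4 => y = D.edge x ∨ y = (x.1, x.2 + 1))
    (a := x) (b := D.edge x) (Or.inl rfl)).symm

theorem comp_rotate (c : D.Crossing) (i : Fin 4) : D.comp (c, i + 1) = D.comp (c, i) :=
  (Quot.sound (r := fun x y : D.Crossing × Fin 4 => y = D.edge x ∨ y = (x.1, x.2 + 1))
    (a := (c, i)) (b := (c, i + 1)) (Or.inr rfl)).symm

theorem base_edge (x : D.Crossing × Fin 4) : D.base (D.edge x) = D.base x := by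
  rw [base, comp_edge, base]

theorem base_rotate (c : D.Crossing) (i : Fin 4) : D.base (c, i + 1) = D.base (c, i) := by
  rw [base, comp_rotate, base]

variable {D} in
/-- A function of ends which is invariant under edges and rotations is constant on components. -/
theorem eq_base {α : Type*} {g : D.Crossing × Fin 4 → α} (he : ∀ x, g (D.edge x) = g x)
    (hr : ∀ c i, g (c, i + 1) = g (c, i)) (x : D.Crossing × Fin 4) : g (D.base x) = g x := by
  let g' : D.Component → α := Quot.lift g (by
    rintro x y (rfl | rfl)
    · exact (he x).symm
    · exact (hr x.1 x.2).symm)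
  exact congrArg g' (Quot.out_eq (D.comp x))

theorem mk_edge_eq_iff (x y : D.Crossing × Fin 4) :
    (Quot.mk _ x : D.Edge) = Quot.mk _ y ↔ x = y ∨ x = D.edge y := by
  constructor
  · intro h
    have key : ∀ a b, Relation.EqvGen (fun x y : D.Crossing × Fin 4 => y = D.edge x) a b →
        a = b ∨ a = D.edge b := by
      intro a b h
      induction h with
      | rel a b h => right; rw [h, D.edge_edge]
      | refl a => exact Or.inl rfl
      | symm a b _ ih =>
        rcases ih with rfl | rfl
        · exact Or.inl rfl
        · right; rw [D.edge_edge]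
      | trans a b c _ _ ih₁ ih₂ =>
        rcases ih₁ with rfl | rfl <;> rcases ih₂ with rfl | rfl
        · exact Or.inl rfl
        · exact Or.inr rfl
        · exact Or.inr rfl
        · left; rw [D.edge_edge]
    exact key _ _ (Quot.eqvGen_exact h)
  · rintro (rfl | rfl)
    · rfl
    · exact (Quot.sound (r := fun x y : D.Crossing × Fin 4 => y = D.edge x) (a := y) rfl).symm

/-- The coboundary from functions of faces to functions of edges. -/
def faceCoboundary : (D.Face → ZMod 2) →ₗ[ZMod 2] (D.Edge → ZMod 2) where
  toFun g := Quot.lift (fun x => g (Quot.mk _ x) + g (Quot.mk _ (D.edge x))) (by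
    rintro x _ rfl
    rw [D.edge_edge, add_comm])
  map_add' g g' := by
    ext ⟨x⟩
    simp only [Pi.add_apply]
    ring
  map_smul' r g := by
    ext ⟨x⟩
    simp only [Pi.smul_apply, smul_eq_mul, RingHom.id_apply]
    ring

/-- The boundary from chains of edges to chains of crossings. -/
def edgeBoundary : (D.Edge → ZMod 2) →ₗ[ZMod 2] (D.Crossing → ZMod 2) where
  toFun h c := ∑ i : Fin 4, h (Quot.mk _ (c, i))
  map_add' h h' := by
    ext c
    simp [Finset.sum_add_distrib]
  map_smul' r h := by
    ext c
    simp [Finset.mul_sum]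

/-- The coboundary from functions of crossings to functions of edges. -/
def crossingCoboundary : (D.Crossing → ZMod 2) →ₗ[ZMod 2] (D.Edge → ZMod 2) where
  toFun u := Quot.lift (fun x => u x.1 + u (D.edge x).1) (by
    rintro x _ rfl
    rw [D.edge_edge, add_comm])
  map_add' g g' := by
    ext ⟨x⟩
    simp only [Pi.add_apply]
    ring
  map_smul' r g := by
    ext ⟨x⟩
    simp only [Pi.smul_apply, smul_eq_mul, RingHom.id_apply]
    ring

/-- A function in the kernel does not change across edges, so it is constant on each component and
is determined by its value at one face per component. -/
theorem finrank_ker_faceCoboundary_le :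
    Module.finrank (ZMod 2) (LinearMap.ker D.faceCoboundary) ≤ Nat.card D.Component := by
  rw [Nat.card_eq_fintype_card, ← Module.finrank_fintype_fun_eq_card (ZMod 2)]
  refine LinearMap.finrank_le_finrank_of_injective
    (f := (LinearMap.funLeft (ZMod 2) (ZMod 2)
      fun κ : D.Component => (Quot.mk _ (Quot.out κ) : D.Face)) ∘ₗ (LinearMap.ker _).subtype) ?_
  rw [injective_iff_map_eq_zero]
  rintro ⟨g, hg⟩ h
  have he : ∀ x, g (Quot.mk _ (D.edge x)) = g (Quot.mk _ x) := by
    intro x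
    have : g (Quot.mk _ x) + g (Quot.mk _ (D.edge x)) = 0 := congrFun hg (Quot.mk _ x)
    rw [add_comm] at this
    exact CharTwo.add_eq_zero.mp this
  have hr : ∀ c i, g (Quot.mk _ (c, i + 1)) = g (Quot.mk _ (c, i)) := by
    intro c i
    rw [← he (c, i)]
    refine congrArg g (Quot.sound ?_).symm
    simp [D.edge_edge]
  ext ⟨x⟩
  have h₁ : g (Quot.mk _ (D.base x)) = g (Quot.mk _ x) :=
    eq_base (g := fun x => g (Quot.mk _ x)) he hr x
  exact h₁.symm.trans (congrFun h (D.comp x))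

theorem finrank_ker_crossingCoboundary_le :
    Module.finrank (ZMod 2) (LinearMap.ker D.crossingCoboundary) ≤ Nat.card D.Component := by
  rw [Nat.card_eq_fintype_card, ← Module.finrank_fintype_fun_eq_card (ZMod 2)]
  refine LinearMap.finrank_le_finrank_of_injective
    (f := (LinearMap.funLeft (ZMod 2) (ZMod 2)
      fun κ : D.Component => (Quot.out κ).1) ∘ₗ (LinearMap.ker _).subtype) ?_
  rw [injective_iff_map_eq_zero]
  rintro ⟨u, hu⟩ h
  have he : ∀ x, u (D.edge x).1 = u x.1 := by
    intro x
    have : u x.1 + u (D.edge x).1 = 0 := congrFun hu (Quot.mk _ x)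
    rw [add_comm] at this
    exact CharTwo.add_eq_zero.mp this
  ext c
  have h₁ : u (D.base (c, 0)).1 = u c :=
    eq_base (g := fun x => u x.1) he (fun _ _ => rfl) (c, 0)
  exact h₁.symm.trans (congrFun h (D.comp (c, 0)))

/-- An edge has two distinct ends, so evaluating at its two crossings is dual to summing over the
four ends at a crossing, loops cancelling in both. Only the equality of ranks is needed later. -/
theorem toMatrix_edgeBoundary :
    LinearMap.toMatrix' D.edgeBoundary = (LinearMap.toMatrix' D.crossingCoboundary).transpose := by
  ext c ⟨x⟩
  rw [Matrix.transpose_apply, LinearMap.toMatrix'_apply, LinearMap.toMatrix'_apply]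
  have h₁ : ∀ i : Fin 4, (Pi.single (Quot.mk _ x) 1 : D.Edge → ZMod 2) (Quot.mk _ (c, i)) =
      (if (c, i) = x then 1 else 0) + (if (c, i) = D.edge x then 1 else 0) := by
    intro i
    simp only [Pi.single_apply, D.mk_edge_eq_iff]
    by_cases h : (c, i) = x
    · have : (c, i) ≠ D.edge x := by rw [h]; exact (D.edge_ne x).symm
      simp [h, (D.edge_ne x).symm]
    · simp [h]
  have h₂ : ∀ y : D.Crossing × Fin 4, ∑ i : Fin 4, (if (c, i) = y then (1 : ZMod 2) else 0) =
      (Pi.single c 1 : D.Crossing → ZMod 2) y.1 := by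
    rintro ⟨d, j⟩
    by_cases h : d = c
    · subst h
      simp
    · have h' : c ≠ d := fun e => h e.symm
      simp [h, h']
  change ∑ i : Fin 4, (Pi.single (Quot.mk _ x) 1 : D.Edge → ZMod 2) (Quot.mk _ (c, i)) =
    (Pi.single c 1 : D.Crossing → ZMod 2) x.1 + (Pi.single c 1 : D.Crossing → ZMod 2) (D.edge x).1
  rw [Finset.sum_congr rfl fun i _ => h₁ i, Finset.sum_add_distrib, h₂, h₂]

theorem finrank_range_edgeBoundary :
    Module.finrank (ZMod 2) (LinearMap.range D.edgeBoundary) =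
      Module.finrank (ZMod 2) (LinearMap.range D.crossingCoboundary) := by
  have h := Matrix.rank_transpose (LinearMap.toMatrix' D.crossingCoboundary)
  rw [← toMatrix_edgeBoundary, Matrix.rank, Matrix.rank, ← Matrix.toLin'_apply',
    ← Matrix.toLin'_apply', Matrix.toLin'_toMatrix', Matrix.toLin'_toMatrix'] at h
  exact h

/-- The first homology of a union of spheres vanishes. The range has dimension at least `F - k`, the
kernel at most `E - (V - k)`, and these bounds agree by Euler's formula. -/
theorem range_faceCoboundary :
    LinearMap.range D.faceCoboundary = LinearMap.ker D.edgeBoundary := by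
  refine Submodule.eq_of_le_of_finrank_le ?_ ?_
  · rintro _ ⟨g, rfl⟩
    ext c
    have h : ∀ i : Fin 4, D.faceCoboundary g (Quot.mk _ (c, i)) =
        g (Quot.mk _ (c, i)) + g (Quot.mk _ (c, i + 1)) := by
      intro i
      change g (Quot.mk _ (c, i)) + g (Quot.mk _ (D.edge (c, i))) = _
      congr 2
      refine Quot.sound ?_
      simp [D.edge_edge]
    change ∑ i : Fin 4, D.faceCoboundary g (Quot.mk _ (c, i)) = 0
    -- Around a crossing each of the four corners is counted twice.
    simp only [h, Fin.sum_univ_four]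
    change _ + _ + (_ + _) + (_ + _) + (_ + g (Quot.mk _ (c, 0))) = _
    generalize g (Quot.mk _ (c, 0)) = a₀
    change a₀ + g (Quot.mk _ (c, 1)) + (_ + g (Quot.mk _ (c, 2))) +
      (_ + g (Quot.mk _ (c, 3))) + _ = _
    generalize g (Quot.mk _ (c, 1)) = a₁
    generalize g (Quot.mk _ (c, 2)) = a₂
    generalize g (Quot.mk _ (c, 3)) = a₃
    revert a₀ a₁ a₂ a₃
    decide
  · have h₁ := LinearMap.finrank_range_add_finrank_ker D.faceCoboundary
    have h₂ := LinearMap.finrank_range_add_finrank_ker D.edgeBoundary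
    have h₃ := LinearMap.finrank_range_add_finrank_ker D.crossingCoboundary
    have h₄ := D.finrank_range_edgeBoundary
    have h₅ := D.finrank_ker_faceCoboundary_le
    have h₆ := D.finrank_ker_crossingCoboundary_le
    have h₇ : Nat.card D.Crossing + Nat.card D.Face = Nat.card D.Edge + 2 * Nat.card D.Component :=
      D.euler
    rw [Module.finrank_fintype_fun_eq_card, ← Nat.card_eq_fintype_card] at h₁ h₂ h₃
    omega

/-- A cycle modulo two of edges: a function of ends, which is invariant under edges and has even
sum around each crossing. -/
structure IsCycle (h : D.Crossing × Fin 4 → ZMod 2) : Prop where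
  edge : ∀ x, h (D.edge x) = h x
  sum : ∀ c, ∑ i, h (c, i) = 0

/-- A potential of a cycle: a function of faces, which jumps along the cycle. -/
structure IsPotential (h g : D.Crossing × Fin 4 → ZMod 2) : Prop where
  edge : ∀ x, g (D.edge x) = g x + h x
  rotate : ∀ c i, g (c, i + 1) = g (c, i) + h (c, i)

variable {D} in
theorem IsCycle.exists_isPotential {h : D.Crossing × Fin 4 → ZMod 2} (hh : D.IsCycle h) :
    ∃ g, D.IsPotential h g := by
  let h' : D.Edge → ZMod 2 := Quot.lift h (by rintro x _ rfl; exact (hh.edge x).symm)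
  have hk : h' ∈ LinearMap.ker D.edgeBoundary := by
    ext c
    exact hh.sum c
  rw [← range_faceCoboundary] at hk
  obtain ⟨g, hg⟩ := hk
  have he : ∀ x, g (Quot.mk _ (D.edge x)) = g (Quot.mk _ x) + h x := by
    intro x
    have : g (Quot.mk _ x) + g (Quot.mk _ (D.edge x)) = h x := congrFun hg (Quot.mk _ x)
    rw [← this, ← add_assoc, CharTwo.add_self_eq_zero, zero_add]
  refine ⟨fun x => g (Quot.mk _ x), he, fun c i => ?_⟩
  rw [← he (c, i)]
  refine congrArg g (Quot.sound ?_).symm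
  simp [D.edge_edge]

/-- The value at `x` of a potential of `h` which vanishes at the base of each component. -/
noncomputable def potential (h : D.Crossing × Fin 4 → ZMod 2) (x : D.Crossing × Fin 4) : ZMod 2 :=
  open Classical in
  if hh : ∃ g, D.IsPotential h g then hh.choose x + hh.choose (D.base x) else 0

variable {D} in
theorem IsCycle.isPotential {h : D.Crossing × Fin 4 → ZMod 2} (hh : D.IsCycle h) :
    D.IsPotential h (D.potential h) := by
  have hg := hh.exists_isPotential.choose_spec
  refine ⟨fun x => ?_, fun c i => ?_⟩
  · simp only [potential, dif_pos hh.exists_isPotential, hg.edge, base_edge]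
    ring
  · simp only [potential, dif_pos hh.exists_isPotential, hg.rotate, base_rotate]
    ring

variable {D} in
-- Two potentials of the same cycle differ by a function invariant under edges and rotations, that
-- is, by a constant on each component; the normalisation at the base fixes it.
theorem IsCycle.potential_eq {h g : D.Crossing × Fin 4 → ZMod 2} (hh : D.IsCycle h)
    (hg : D.IsPotential h g) (x : D.Crossing × Fin 4) :
    D.potential h x = g x + g (D.base x) := by
  have hp := hh.exists_isPotential.choose_spec
  rw [potential, dif_pos hh.exists_isPotential]
  generalize hh.exists_isPotential.choose = p at *
  have := eq_base (g := fun x => p x + g x)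
    (fun x => by
      simp only [hp.edge, hg.edge]
      linear_combination CharTwo.add_self_eq_zero (h x))
    (fun c i => by
      simp only [hp.rotate, hg.rotate]
      linear_combination CharTwo.add_self_eq_zero (h (c, i))) x
  linear_combination this + CharTwo.add_self_eq_zero (p x) - CharTwo.add_self_eq_zero (g (D.base x))

theorem base_base (x : D.Crossing × Fin 4) : D.base (D.base x) = D.base x :=
  eq_base (g := D.base) D.base_edge D.base_rotate x

theorem potential_base (h : D.Crossing × Fin 4 → ZMod 2) (x : D.Crossing × Fin 4) :
    D.potential h (D.base x) = 0 := by
  rw [potential]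
  split_ifs
  · rw [base_base, CharTwo.add_self_eq_zero]
  · rfl

variable {D} in
theorem IsCycle.potential_add {h h' : D.Crossing × Fin 4 → ZMod 2} (hh : D.IsCycle h)
    (hh' : D.IsCycle h') (x : D.Crossing × Fin 4) :
    D.potential (h + h') x = D.potential h x + D.potential h' x := by
  have hs : D.IsCycle (h + h') := ⟨fun x => by simp [hh.edge, hh'.edge], fun c => by
    simp [Finset.sum_add_distrib, hh.sum, hh'.sum]⟩
  have hp : D.IsPotential (h + h') (D.potential h + D.potential h') :=
    ⟨fun x => by
      simp only [Pi.add_apply, hh.isPotential.edge, hh'.isPotential.edge]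
      ring,
    fun c i => by
      simp only [Pi.add_apply, hh.isPotential.rotate, hh'.isPotential.rotate]
      ring⟩
  rw [hs.potential_eq hp]
  simp [potential_base]

/-! ### The checkerboard colouring -/

/-- The checkerboard colouring of the faces. -/
noncomputable def color : D.Crossing × Fin 4 → ZMod 2 := D.potential 1

/-- All edges together form a cycle because every vertex has even valence. -/
theorem isPotential_color : D.IsPotential 1 D.color :=
  IsCycle.isPotential ⟨fun _ => rfl, fun c => by
    simp only [Pi.one_apply, Fin.sum_univ_four]
    decide⟩

theorem color_edge (x : D.Crossing × Fin 4) : D.color (D.edge x) = D.color x + 1 :=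
  D.isPotential_color.edge x

theorem color_rotate (c : D.Crossing) (i : Fin 4) : D.color (c, i + 1) = D.color (c, i) + 1 :=
  D.isPotential_color.rotate c i

end LinkDiagram

/-! ### Cycles of a permutation composed with a transposition -/

namespace Equiv.Perm

variable {α : Type*} [DecidableEq α] {f g : Equiv.Perm α} {p : α → Prop} {x y : α}

/-- As long as the `f`-orbit of `x` avoids `x` and `y`, the transposition has no effect. The
relation is only required on an `f`-stable set `p`; in the application this is the set of ends of
one colour. -/
theorem pow_apply_eq_of_eq_swap (hg : ∀ z, p z → g z = Equiv.swap x y (f z))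
    (hp : ∀ z, p z → p (f z)) (hx : p x) (n : ℕ)
    (hn : ∀ i, 0 < i → i ≤ n → (f ^ i) x ≠ x ∧ (f ^ i) x ≠ y) :
    (g ^ n) x = (f ^ n) x ∧ p ((f ^ n) x) := by
  induction n with
  | zero => exact ⟨rfl, hx⟩
  | succ n ih =>
    obtain ⟨h₁, h₂⟩ := ih fun i hi hin => hn i hi (by omega)
    have h := hn (n + 1) (by omega) le_rfl
    rw [pow_succ', mul_apply] at h
    rw [pow_succ', pow_succ', mul_apply, mul_apply, h₁, hg _ h₂,
      Equiv.swap_apply_of_ne_of_ne h.1 h.2]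
    exact ⟨rfl, hp _ h₂⟩

theorem pow_succ_apply_eq_of_eq_swap (hg : ∀ z, p z → g z = Equiv.swap x y (f z))
    (hp : ∀ z, p z → p (f z)) (hx : p x) (n : ℕ)
    (hn : ∀ i, 0 < i → i ≤ n → (f ^ i) x ≠ x ∧ (f ^ i) x ≠ y) :
    (g ^ (n + 1)) x = Equiv.swap x y ((f ^ (n + 1)) x) := by
  obtain ⟨h₁, h₂⟩ := pow_apply_eq_of_eq_swap hg hp hx n hn
  rw [pow_succ', pow_succ', mul_apply, mul_apply, h₁, hg _ h₂]

variable [Finite α]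

/-- At the first time `k` when `f` carries `x` to `y`, `g` carries `x` back to `x` instead, so the
`g`-cycle of `x` closes up before it meets `y`. -/
theorem SameCycle.not_sameCycle_of_eq_swap (hg : ∀ z, p z → g z = Equiv.swap x y (f z))
    (hp : ∀ z, p z → p (f z)) (hx : p x) (hxy : x ≠ y) (h : f.SameCycle x y) :
    ¬ g.SameCycle x y := by
  classical
  have hex : ∃ i, (f ^ i) x = y := h.exists_nat_pow_eq
  set k := Nat.find hex with hk
  have hkx : (f ^ k) x = y := Nat.find_spec hex
  have hmin : ∀ i < k, (f ^ i) x ≠ y := fun i hi => Nat.find_min hex hi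
  have hk0 : 0 < k := by
    rcases Nat.eq_zero_or_pos k with h0 | h0
    · rw [h0] at hkx
      exact absurd hkx hxy
    · exact h0
  have hno : ∀ i, 0 < i → i < k → (f ^ i) x ≠ x ∧ (f ^ i) x ≠ y := by
    intro i hi hik
    refine ⟨fun e => hmin (k - i) (by omega) ?_, hmin i hik⟩
    have : (f ^ (k - i)) ((f ^ i) x) = y := by
      rw [← mul_apply, ← pow_add, Nat.sub_add_cancel hik.le, hkx]
    rwa [e] at this
  have hgk : (g ^ k) x = x := by
    obtain ⟨m, hm⟩ : ∃ m, k = m + 1 := ⟨k - 1, by omega⟩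
    rw [hm, pow_succ_apply_eq_of_eq_swap hg hp hx m fun i hi him => hno i hi (by omega), ← hm, hkx,
      Equiv.swap_apply_right]
  intro hgxy
  obtain ⟨n, hn⟩ := hgxy.exists_nat_pow_eq
  have hmul : ∀ q : ℕ, (g ^ (k * q)) x = x := by
    intro q
    induction q with
    | zero => rfl
    | succ q ih => rw [Nat.mul_succ, pow_add, mul_apply, hgk, ih]
  have hr : (g ^ (n % k)) x = y := by
    rw [← hn]
    conv_rhs => rw [← Nat.mod_add_div n k, pow_add, mul_apply, hmul]
  have hlt := Nat.mod_lt n hk0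
  rw [(pow_apply_eq_of_eq_swap hg hp hx (n % k) fun i hi him => hno i hi (by omega)).1] at hr
  exact hmin _ hlt hr

/-- At the first time when `f` returns `x` to itself, without having met `y`, `g` arrives at `y`. -/
theorem sameCycle_of_not_sameCycle_of_eq_swap (hg : ∀ z, p z → g z = Equiv.swap x y (f z))
    (hp : ∀ z, p z → p (f z)) (hx : p x) (h : ¬ f.SameCycle x y) : g.SameCycle x y := by
  classical
  have hex : ∃ i, 0 < i ∧ (f ^ i) x = x := by
    refine ⟨orderOf f, orderOf_pos f, ?_⟩
    rw [pow_orderOf_eq_one, one_apply]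
  set k := Nat.find hex with hk
  obtain ⟨hk0, hkx⟩ : 0 < k ∧ (f ^ k) x = x := Nat.find_spec hex
  have hno : ∀ i, 0 < i → i < k → (f ^ i) x ≠ x ∧ (f ^ i) x ≠ y := fun i hi hik =>
    ⟨fun e => Nat.find_min hex hik ⟨hi, e⟩, fun e => h ⟨i, by rw [zpow_natCast, e]⟩⟩
  obtain ⟨m, hm⟩ : ∃ m, k = m + 1 := ⟨k - 1, by omega⟩
  refine ⟨(k : ℤ), ?_⟩
  rw [zpow_natCast, hm,
    pow_succ_apply_eq_of_eq_swap hg hp hx m fun i hi him => hno i hi (by omega), ← hm, hkx,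
    Equiv.swap_apply_left]

end Equiv.Perm

namespace LinkDiagram

variable (D : LinkDiagram)

/-! ### Circles of smoothings -/

theorem smooth_smooth (S : Finset D.Crossing) (x : D.Crossing × Fin 4) :
    D.smooth S (D.smooth S x) = x := by
  obtain ⟨c, i⟩ := x
  by_cases h : c ∈ S <;> fin_cases i <;> simp [smooth, h]

theorem color_smooth (S : Finset D.Crossing) (x : D.Crossing × Fin 4) :
    D.color (D.smooth S x) = D.color x + 1 := by
  obtain ⟨c, i⟩ := x
  have h₁ : D.color (c, 1) = D.color (c, 0) + 1 := D.color_rotate c 0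
  have h₂ : D.color (c, 2) = D.color (c, 1) + 1 := D.color_rotate c 1
  have h₃ : D.color (c, 3) = D.color (c, 2) + 1 := D.color_rotate c 2
  have h4 : ∀ a : ZMod 2, a + 1 + 1 = a := by decide
  by_cases h : c ∈ S <;> fin_cases i <;> simp [smooth, h, h₁, h₂, h₃, h4]

theorem circle_edge (S : Finset D.Crossing) (x : D.Crossing × Fin 4) :
    D.circle S (Sum.inl (D.edge x)) = D.circle S (Sum.inl x) :=
  (Quot.sound (Adj.edge x)).symm

theorem circle_smooth (S : Finset D.Crossing) (x : D.Crossing × Fin 4) :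
    D.circle S (Sum.inl (D.smooth S x)) = D.circle S (Sum.inl x) :=
  (Quot.sound (Adj.smooth x)).symm

/-- The permutation of ends which traverses an edge, and then an arc of the smoothing. -/
def traverse (S : Finset D.Crossing) : Equiv.Perm (D.Crossing × Fin 4) :=
  Function.Involutive.toPerm (D.smooth S) (D.smooth_smooth S) *
    Function.Involutive.toPerm D.edge D.edge_edge

theorem traverse_apply (S : Finset D.Crossing) (x : D.Crossing × Fin 4) :
    D.traverse S x = D.smooth S (D.edge x) := rfl

theorem color_traverse (S : Finset D.Crossing) (x : D.Crossing × Fin 4) :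
    D.color (D.traverse S x) = D.color x := by
  rw [traverse_apply, color_smooth, color_edge, add_assoc]
  exact add_zero _

/-- Two ends of the same colour are on the same circle if and only if they are in the same orbit. -/
theorem circle_eq_iff_sameCycle (S : Finset D.Crossing) {x y : D.Crossing × Fin 4}
    (hxy : D.color x = D.color y) :
    D.circle S (Sum.inl x) = D.circle S (Sum.inl y) ↔ (D.traverse S).SameCycle x y := by
  constructor
  · let r := Equiv.Perm.SameCycle.setoid (D.traverse S)
    -- The two ends of an edge have opposite colours; `ν` selects the one coloured like `x`, which
    -- makes the orbit well defined on circles.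
    let ν : D.Crossing × Fin 4 → D.Crossing × Fin 4 := fun z =>
      if D.color z = D.color x then z else D.edge z
    have h4 : ∀ a b : ZMod 2, a ≠ b → a + 1 = b := by decide
    have h5 : ∀ a : ZMod 2, a + 1 ≠ a := by decide
    let q : D.Point → Quotient r ⊕ Fin D.free := Sum.map (fun z => Quotient.mk r (ν z)) id
    have hq : ∀ a b, D.Adj S a b → q a = q b := by
      rintro _ _ (z | z)
      · refine congrArg Sum.inl (congrArg (Quotient.mk r) ?_)
        by_cases hz : D.color z = D.color x
        · simp [ν, hz, color_edge, D.edge_edge]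
        · simp [ν, hz, color_edge, h4 _ _ hz]
      · refine congrArg Sum.inl (Quotient.sound (s := r) ?_)
        change (D.traverse S).SameCycle _ _
        by_cases hz : D.color z = D.color x
        · simp only [ν, hz, color_smooth, h5, if_true, if_false]
          refine Equiv.Perm.SameCycle.symm ⟨1, ?_⟩
          rw [zpow_one, traverse_apply, D.edge_edge, smooth_smooth]
        · simp only [ν, hz, color_smooth, h4 _ _ hz, if_true, if_false]
          refine ⟨1, ?_⟩
          rw [zpow_one, traverse_apply, D.edge_edge]
    intro h
    have h' : q (Sum.inl x) = q (Sum.inl y) := congrArg (Quot.lift q hq) h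
    have h'' : (D.traverse S).SameCycle (ν x) (ν y) :=
      Quotient.exact (s := r) (Sum.inl.inj h')
    simpa only [ν, hxy, if_true] using h''
  · have h₁ : ∀ z, D.circle S (Sum.inl (D.traverse S z)) = D.circle S (Sum.inl z) := fun z => by
      rw [traverse_apply, circle_smooth, circle_edge]
    intro h
    obtain ⟨n, rfl⟩ := h.exists_nat_pow_eq
    induction n with
    | zero => rfl
    | succ n ih =>
      rw [pow_succ', Equiv.Perm.mul_apply, h₁]
      exact ih (by rw [hxy, pow_succ', Equiv.Perm.mul_apply, color_traverse]) ⟨n, rfl⟩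

theorem color_two (c : D.Crossing) : D.color (c, 2) = D.color (c, 0) := by
  have h₁ : D.color (c, 1) = D.color (c, 0) + 1 := D.color_rotate c 0
  have h₂ : D.color (c, 2) = D.color (c, 1) + 1 := D.color_rotate c 1
  rw [h₂, h₁, add_assoc]
  exact add_zero _

/-- A crossing either merges two circles or splits a circle. -/
theorem side_insert_iff {S : Finset D.Crossing} {c : D.Crossing} (hc : c ∉ S) :
    D.side₀ (insert c S) c = D.side₂ (insert c S) c ↔ D.side₀ S c ≠ D.side₂ S c := by
  have hne : ((c, 0) : D.Crossing × Fin 4) ≠ (c, 2) := by simp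
  -- From an end coloured like `(c, 0)`, an edge can reach `c` only at `(c, 1)` or `(c, 3)`. The two
  -- smoothings send these to `(c, 0)` and `(c, 2)` in opposite ways.
  have hg : ∀ z, D.color z = D.color (c, 0) → D.traverse (insert c S) z =
      Equiv.swap (c, 0) (c, 2) (D.traverse S z) := by
    intro z hz
    rw [← color_traverse D S] at hz
    rw [traverse_apply, traverse_apply] at *
    generalize D.edge z = w at *
    obtain ⟨d, i⟩ := w
    by_cases hd : d = c
    · subst hd
      have h₁ : D.color (d, 1) = D.color (d, 0) + 1 := D.color_rotate d 0
      have h₂ : D.color (d, 2) = D.color (d, 1) + 1 := D.color_rotate d 1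
      have h₃ : D.color (d, 3) = D.color (d, 2) + 1 := D.color_rotate d 2
      have h4 : ∀ a : ZMod 2, a + 1 + 1 = a := by decide
      fin_cases i <;> simp [smooth, hc, h₁, h₂, h₃, h4] at hz ⊢
    · have h : D.smooth (insert c S) (d, i) = D.smooth S (d, i) := by
        simp [smooth, hd]
      rw [h, Equiv.swap_apply_of_ne_of_ne]
      · exact fun e => hd (congrArg Prod.fst e)
      · exact fun e => hd (congrArg Prod.fst e)
  have hp : ∀ z, D.color z = D.color (c, 0) → D.color (D.traverse S z) = D.color (c, 0) :=
    fun z hz => by rw [color_traverse, hz]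
  rw [side₀, side₂, side₀, side₂, ne_eq, circle_eq_iff_sameCycle D _ (D.color_two c).symm,
    circle_eq_iff_sameCycle D _ (D.color_two c).symm]
  constructor
  · intro h h'
    exact h'.not_sameCycle_of_eq_swap (p := fun z => D.color z = D.color (c, 0)) hg hp rfl hne h
  · exact Equiv.Perm.sameCycle_of_not_sameCycle_of_eq_swap
      (p := fun z => D.color z = D.color (c, 0)) hg hp rfl

/-- Two states which agree apart from the crossing `c`. -/
def AgreeOff (S T : Finset D.Crossing) (c : D.Crossing) : Prop := ∀ d ≠ c, (d ∈ S ↔ d ∈ T)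

/-! ### Circles under a change of one smoothing -/

variable {D}

theorem agreeOff_insert (S : Finset D.Crossing) (c : D.Crossing) : D.AgreeOff S (insert c S) c :=
  fun d hd => by simp [hd]

theorem AgreeOff.symm {S T : Finset D.Crossing} {c : D.Crossing} (h : D.AgreeOff S T c) :
    D.AgreeOff T S c := fun d hd => (h d hd).symm

theorem circle_eq_side (S : Finset D.Crossing) (c : D.Crossing) (i : Fin 4) :
    D.circle S (Sum.inl (c, i)) = D.side₀ S c ∨ D.circle S (Sum.inl (c, i)) = D.side₂ S c := by
  have h₁ := D.circle_smooth S (c, 1)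
  have h₃ := D.circle_smooth S (c, 3)
  by_cases hc : c ∈ S
  · simp only [smooth, hc] at h₁ h₃
    fin_cases i
    exacts [Or.inl rfl, Or.inr h₁.symm, Or.inr rfl, Or.inl h₃.symm]
  · simp only [smooth, hc] at h₁ h₃
    fin_cases i
    exacts [Or.inl rfl, Or.inl h₁.symm, Or.inr rfl, Or.inr h₃.symm]

/-- The circle through a point is adjacent to the crossing `c`. -/
def Near (S : Finset D.Crossing) (c : D.Crossing) (p : D.Point) : Prop :=
  D.circle S p = D.side₀ S c ∨ D.circle S p = D.side₂ S c

theorem near_of_circle_eq {S : Finset D.Crossing} {c : D.Crossing} {p q : D.Point}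
    (h : D.circle S p = D.circle S q) (hp : Near S c p) : Near S c q := by
  rwa [Near, ← h]

/-- A change of the smoothing at `c` affects only circles adjacent to `c`. -/
theorem AgreeOff.circle_eq_or_near {S T : Finset D.Crossing} {c : D.Crossing}
    (hST : D.AgreeOff S T c) {p q : D.Point} (h : D.circle S p = D.circle S q) :
    D.circle T p = D.circle T q ∨ (Near T c p ∧ Near T c q) := by
  have key : ∀ y z, Relation.EqvGen (D.Adj S) y z →
      D.circle T y = D.circle T z ∨ (Near T c y ∧ Near T c z) := by
    intro y z h
    induction h with
    | refl => exact Or.inl rfl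
    | symm a b _ ih => exact ih.imp Eq.symm And.symm
    | trans a b d _ _ ih₁ ih₂ =>
      rcases ih₁ with h₁ | ⟨h₁, h₁'⟩ <;> rcases ih₂ with h₂ | ⟨h₂, h₂'⟩
      · exact Or.inl (h₁.trans h₂)
      · exact Or.inr ⟨near_of_circle_eq h₁.symm h₂, h₂'⟩
      · exact Or.inr ⟨h₁, near_of_circle_eq h₂ h₁'⟩
      · exact Or.inr ⟨h₁, h₂'⟩
    | rel a b hab =>
      cases hab with
      | edge x => exact Or.inl (D.circle_edge T x).symm
      | smooth x =>
        by_cases hx : x.1 = c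
        · subst hx
          exact Or.inr ⟨circle_eq_side T x.1 x.2, circle_eq_side T x.1 _⟩
        · left
          have hs : D.smooth S x = D.smooth T x := by simp [LinkDiagram.smooth, hST _ hx]
          rw [hs, circle_smooth]
  exact key _ _ (Quot.eqvGen_exact h)

theorem AgreeOff.near_iff {S T : Finset D.Crossing} {c : D.Crossing}
    (hST : D.AgreeOff S T c) (p : D.Point) : Near S c p ↔ Near T c p := by
  have key : ∀ {S T : Finset D.Crossing}, D.AgreeOff S T c → Near S c p → Near T c p := by
    intro S T hST h
    rcases h with h | h <;> rcases hST.circle_eq_or_near h with h' | h'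
    exacts [Or.inl h', h'.1, Or.inr h', h'.1]
  exact ⟨key hST, key hST.symm⟩

/-- When the two sides of `c` agree in `T`, circles of `S` are contained in circles of `T`. -/
theorem AgreeOff.circle_eq {S T : Finset D.Crossing} {c : D.Crossing}
    (hST : D.AgreeOff S T c) (hT : D.side₀ T c = D.side₂ T c) {p q : D.Point}
    (h : D.circle S p = D.circle S q) : D.circle T p = D.circle T q := by
  rcases hST.circle_eq_or_near h with h | ⟨hp, hq⟩
  · exact h
  · rw [Near, ← hT, or_self] at hp hq
    rw [hp, hq]

end LinkDiagram

/-- A Frobenius structure on a commutative algebra is cocommutative. -/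
theorem FrobeniusStructure.comm_comul_one {K A : Type*} [CommRing K] [CommRing A] [Algebra K A]
    (F : FrobeniusStructure K A) : TensorProduct.comm K A A (F.comul 1) = F.comul 1 := by
  let _ := F.toCoalgebra
  let r := Coalgebra.Repr.arbitrary K (1 : A)
  have hr : ∑ i ∈ r.index, r.left i ⊗ₜ[K] r.right i = F.comul 1 := r.eq
  -- The dual basis property of `Δ(1)`: apply the counit law to `Δ(z) = Δ(1) (1 ⊗ z)`.
  have key : ∀ z : A, ∑ i ∈ r.index, F.counit (r.right i * z) • r.left i = z := by
    intro z
    have h₁ : F.comul z = ∑ i ∈ r.index, r.left i ⊗ₜ[K] (r.right i * z) := by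
      have := F.comul_mul_right 1 z
      rw [one_mul, ← hr, Finset.sum_mul] at this
      simpa using this
    have h₂ := LinearMap.congr_fun F.lTensor_counit_comp_comul z
    rw [LinearMap.comp_apply, h₁, map_sum] at h₂
    simpa using congrArg (TensorProduct.rid K A) h₂
  have h₁ : TensorProduct.comm K A A (F.comul 1) = ∑ j ∈ r.index, ∑ i ∈ r.index,
      F.counit (r.right i * r.right j) • (r.left i ⊗ₜ[K] r.left j) := by
    rw [← hr, map_sum]
    refine Finset.sum_congr rfl fun j _ => ?_
    rw [TensorProduct.comm_tmul]
    conv_lhs => rw [← key (r.right j), TensorProduct.sum_tmul]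
    simp only [TensorProduct.smul_tmul']
  have h₂ : F.comul 1 = ∑ j ∈ r.index, ∑ i ∈ r.index,
      F.counit (r.right i * r.right j) • (r.left j ⊗ₜ[K] r.left i) := by
    rw [← hr]
    refine Finset.sum_congr rfl fun j _ => ?_
    conv_lhs => rw [← key (r.right j), TensorProduct.tmul_sum]
    simp only [TensorProduct.tmul_smul]
  -- The coefficients `ε(r_i r_j)` are symmetric in `i` and `j`, since `A` is commutative.
  rw [h₁, h₂, Finset.sum_comm]
  simp only [mul_comm]

namespace LinkDiagram

variable {K A : Type*} [CommRing K] [CommRing A] [Algebra K A] {D : LinkDiagram}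

/-! ### The structure maps are linear over the algebra of points -/

variable (K) in
/-- The inclusion of the tensor factor of the circle through a given point. -/
noncomputable def pt (S : Finset D.Crossing) (p : D.Point) : A →ₐ[K] StateModule K A D S :=
  incl K A D (D.circle S p)

variable (K) in
/-- The map from `A ⊗ A` to the tensor factors of the circles through two given points. -/
noncomputable def pt₂ (S : Finset D.Crossing) (p q : D.Point) :
    A ⊗[K] A →ₐ[K] StateModule K A D S :=
  Algebra.TensorProduct.lift (pt K S p) (pt K S q) fun _ _ => Commute.all _ _

/-- A linear map between state modules, which is linear over the tensor product of copies of `A`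
indexed by the points of the diagram. -/
def PointLinear {S T : Finset D.Crossing} (f : StateModule K A D S →ₗ[K] StateModule K A D T) :
    Prop :=
  ∀ (p : D.Point) (a : A) (x : StateModule K A D S), f (pt K S p a * x) = pt K T p a * f x

theorem pt_congr {S : Finset D.Crossing} {p q : D.Point} (h : D.circle S p = D.circle S q) :
    pt (A := A) K S p = pt K S q := by
  rw [pt, h, pt]

theorem circle_out {S : Finset D.Crossing} (C : D.Circle S) : D.circle S (Quot.out C) = C :=
  Quot.out_eq C

theorem incl_eq_pt {S : Finset D.Crossing} (C : D.Circle S) :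
    incl K A D C = pt K S (Quot.out C) := by
  rw [pt, circle_out]

theorem tprod_eq_prod_incl {S : Finset D.Crossing} (v : D.Circle S → A) :
    PiTensorProduct.tprod K v = ∏ C, incl K A D C (v C) := by
  have h : v = ∏ C, Pi.mulSingle C (v C) := (Finset.univ_prod_mulSingle v).symm
  conv_lhs => rw [h]
  rw [PiTensorProduct.tprod_prod]
  rfl

theorem prod_incl_mul {S : Finset D.Crossing} {M : Type*} [CommMonoid M]
    (g : D.Circle S → M) (C : D.Circle S) (m : M) :
    ∏ C', (if C' = C then m else 1) * g C' = m * ∏ C', g C' := by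
  rw [Finset.prod_mul_distrib, Finset.prod_ite_eq' Finset.univ C, if_pos (Finset.mem_univ _)]

theorem incl_mul_tprod {S : Finset D.Crossing} (C : D.Circle S) (a : A) (v : D.Circle S → A) :
    incl K A D C a * PiTensorProduct.tprod K v = PiTensorProduct.tprod K (Pi.mulSingle C a * v) :=
  PiTensorProduct.tprod_mul_tprod _ _

/-- A point-linear map is determined by its value at `1`. -/
theorem PointLinear.ext {S T : Finset D.Crossing}
    {f g : StateModule K A D S →ₗ[K] StateModule K A D T} (hf : PointLinear f)
    (hg : PointLinear g) (h : f 1 = g 1) : f = g := by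
  refine PiTensorProduct.ext (MultilinearMap.ext fun v => ?_)
  change f (PiTensorProduct.tprod K v) = g (PiTensorProduct.tprod K v)
  rw [tprod_eq_prod_incl]
  induction (Finset.univ : Finset (D.Circle S)) using Finset.induction_on with
  | empty => exact h
  | insert C s hC ih => rw [Finset.prod_insert hC, incl_eq_pt, hf, hg, ih]

theorem PointLinear.comp {S T U : Finset D.Crossing}
    {g : StateModule K A D T →ₗ[K] StateModule K A D U}
    {f : StateModule K A D S →ₗ[K] StateModule K A D T} (hg : PointLinear g)
    (hf : PointLinear f) : PointLinear (g ∘ₗ f) := fun p a x => by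
  rw [LinearMap.comp_apply, hf, hg, LinearMap.comp_apply]

theorem PointLinear.mulLeft {S T : Finset D.Crossing}
    {f : StateModule K A D S →ₗ[K] StateModule K A D T} (hf : PointLinear f)
    (u : StateModule K A D T) : PointLinear (LinearMap.mulLeft K u ∘ₗ f) := fun p a x => by
  rw [LinearMap.comp_apply, hf, LinearMap.comp_apply, LinearMap.mulLeft_apply,
    LinearMap.mulLeft_apply, mul_left_comm]

theorem PointLinear.comp_mulLeft {S T : Finset D.Crossing}
    {f : StateModule K A D S →ₗ[K] StateModule K A D T} (hf : PointLinear f)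
    (u : StateModule K A D S) : PointLinear (f ∘ₗ LinearMap.mulLeft K u) := fun p a x => by
  rw [LinearMap.comp_apply, LinearMap.comp_apply, LinearMap.mulLeft_apply,
    LinearMap.mulLeft_apply, mul_left_comm, hf]

theorem PointLinear.map_pt₂_mul {S T : Finset D.Crossing}
    {f : StateModule K A D S →ₗ[K] StateModule K A D T} (hf : PointLinear f) (p q : D.Point)
    (t : A ⊗[K] A) (x : StateModule K A D S) : f (pt₂ K S p q t * x) = pt₂ K T p q t * f x := by
  induction t using TensorProduct.induction_on with
  | zero => simp
  | tmul a b => simp only [pt₂, Algebra.TensorProduct.lift_tmul, mul_assoc, hf p, hf q]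
  | add s t hs ht => rw [map_add, map_add, add_mul, add_mul, map_add, hs, ht]

theorem pt₂_congr {S : Finset D.Crossing} {p q p' q' : D.Point}
    (hp : D.circle S p = D.circle S p') (hq : D.circle S q = D.circle S q') (t : A ⊗[K] A) :
    pt₂ K S p q t = pt₂ K S p' q' t := by
  rw [pt₂, pt₂]
  congr 2
  · exact pt_congr hp
  · exact pt_congr hq

theorem pt₂_comm (S : Finset D.Crossing) (p q : D.Point) (t : A ⊗[K] A) :
    pt₂ K S p q (TensorProduct.comm K A A t) = pt₂ K S q p t := by
  induction t using TensorProduct.induction_on with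
  | zero => simp
  | tmul a b => simp [pt₂, mul_comm]
  | add s t hs ht => rw [map_add, map_add, map_add, hs, ht]

theorem edgeMap_tprod (F : FrobeniusStructure K A) (S T : Finset D.Crossing) (c : D.Crossing)
    (v : D.Circle S → A) :
    edgeMap F D S T c (PiTensorProduct.tprod K v) = ∏ C, circleMap F D S T c C (v C) := by
  rw [edgeMap, PiTensorProduct.lift.tprod, MultilinearMap.compLinearMap_apply,
    MultilinearMap.mkPiAlgebra_apply]

/-- For a split, the bimodule property lets the scalar enter whichever new factor contains `p`. For
a merger, the two sides of `c` have become one circle, which contains `p`. -/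
theorem circleMap_mul (F : FrobeniusStructure K A) {S : Finset D.Crossing} {c : D.Crossing}
    (hc : c ∉ S) (p : D.Point) (a b : A) :
    circleMap F D S (insert c S) c (D.circle S p) (a * b) =
      pt K (insert c S) p a * circleMap F D S (insert c S) c (D.circle S p) b := by
  have hnear := (agreeOff_insert S c).near_iff p
  unfold circleMap
  split_ifs with h₁ h₂
  · have hp : Near (insert c S) c p := hnear.mp (Or.inl h₁.2)
    simp only [LinearMap.comp_apply, AlgHom.toLinearMap_apply]
    rcases hp with hp | hp
    · rw [F.comul_mul_left, map_mul, Algebra.TensorProduct.lift_tmul, map_one, mul_one, pt, hp]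
    · rw [mul_comm a b, F.comul_mul_right, map_mul, Algebra.TensorProduct.lift_tmul, map_one,
        one_mul, mul_comm, pt, hp]
  · have hp : Near (insert c S) c p := hnear.mp h₂
    have hs : D.side₀ S c ≠ D.side₂ S c := by
      intro e
      rw [← e, or_self] at h₂
      exact h₁ ⟨e, h₂⟩
    rw [Near, ← (D.side_insert_iff hc).mpr hs, or_self] at hp
    rw [AlgHom.toLinearMap_apply, AlgHom.toLinearMap_apply, map_mul, pt, hp]
  · rw [not_or] at h₂
    rw [AlgHom.toLinearMap_apply, AlgHom.toLinearMap_apply, map_mul, pt,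
      D.circle_eq_corr S c p h₂.1 h₂.2]

theorem pointLinear_edgeMap (F : FrobeniusStructure K A) {S : Finset D.Crossing} {c : D.Crossing}
    (hc : c ∉ S) : PointLinear (edgeMap F D S (insert c S) c) := by
  intro p a x
  induction x using PiTensorProduct.induction_on with
  | smul_tprod r v =>
    rw [mul_smul_comm, map_smul, map_smul, mul_smul_comm, pt, incl_mul_tprod, edgeMap_tprod,
      edgeMap_tprod, ← prod_incl_mul _ (D.circle S p)]
    congr 1
    refine Finset.prod_congr rfl fun C _ => ?_
    by_cases h : C = D.circle S p
    · subst h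
      rw [Pi.mul_apply, Pi.mulSingle_eq_same, if_pos rfl, circleMap_mul F hc]
    · rw [Pi.mul_apply, Pi.mulSingle_eq_of_ne h, if_neg h, one_mul, one_mul]
  | add x y hx hy => rw [mul_add, map_add, map_add, mul_add, hx, hy]

theorem edgeMap_one_of_split (F : FrobeniusStructure K A) {S : Finset D.Crossing} {c : D.Crossing}
    (h : D.side₀ S c = D.side₂ S c) (T : Finset D.Crossing) :
    edgeMap F D S T c 1 = pt₂ K T (Sum.inl (c, 0)) (Sum.inl (c, 2)) (F.comul 1) := by
  rw [PiTensorProduct.one_def, edgeMap_tprod, Finset.prod_eq_single (D.side₀ S c)]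
  · rw [circleMap, if_pos ⟨h, rfl⟩]
    rfl
  · intro C _ hC
    rw [circleMap, if_neg fun h' => hC h'.2, if_neg (by rwa [← h, or_self])]
    exact map_one (incl K A D _)
  · exact fun h => absurd (Finset.mem_univ _) h

theorem edgeMap_one_of_merge (F : FrobeniusStructure K A) {S : Finset D.Crossing} {c : D.Crossing}
    (h : D.side₀ S c ≠ D.side₂ S c) (T : Finset D.Crossing) : edgeMap F D S T c 1 = 1 := by
  rw [PiTensorProduct.one_def, edgeMap_tprod]
  refine Finset.prod_eq_one fun C _ => ?_
  rw [circleMap, if_neg fun h' => h h'.1]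
  split_ifs <;> exact map_one (incl K A D _)

/-! ### Commutativity of the cube -/

/-- The case of two interlaced chords of one circle. A merger at `b` could not separate the sides of
`a`, so `b` splits; the two pieces contain the sides of `a`, one each, and are joined again at `a`.
-/
theorem square_of_split_of_merge {S : Finset D.Crossing} {a b : D.Crossing} (ha : a ∉ S)
    (hb : b ∉ S) (hab : a ≠ b) (h₁ : D.side₀ S a = D.side₂ S a)
    (h₂ : D.side₀ (insert b S) a ≠ D.side₂ (insert b S) a) :
    D.side₀ S b = D.side₂ S b ∧ D.side₀ (insert a S) b ≠ D.side₂ (insert a S) b ∧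
      ((D.side₀ (insert b (insert a S)) a = D.side₀ (insert b (insert a S)) b ∧
        D.side₂ (insert b (insert a S)) a = D.side₂ (insert b (insert a S)) b) ∨
      (D.side₀ (insert b (insert a S)) a = D.side₂ (insert b (insert a S)) b ∧
        D.side₂ (insert b (insert a S)) a = D.side₀ (insert b (insert a S)) b)) := by
  have hab' : a ∉ insert b S := by simp [ha, hab]
  have hba' : b ∉ insert a S := by simp [hb, hab.symm]
  have hU : insert b (insert a S) = insert a (insert b S) := Finset.insert_comm b a S
  have hsb : D.side₀ S b = D.side₂ S b := by
    by_contra h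
    exact h₂ ((agreeOff_insert S b).circle_eq ((D.side_insert_iff hb).mpr h) h₁)
  have haU := (D.side_insert_iff hab').mpr h₂
  have hTU := fun {p q} =>
    (agreeOff_insert (insert b S) a).circle_eq haU (p := p) (q := q)
  have hnear := ((agreeOff_insert S b).circle_eq_or_near h₁).resolve_left h₂
  have hrel : (D.side₀ (insert b (insert a S)) a = D.side₀ (insert b (insert a S)) b ∧
        D.side₂ (insert b (insert a S)) a = D.side₂ (insert b (insert a S)) b) ∨
      (D.side₀ (insert b (insert a S)) a = D.side₂ (insert b (insert a S)) b ∧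
        D.side₂ (insert b (insert a S)) a = D.side₀ (insert b (insert a S)) b) := by
    rw [hU]
    rcases hnear with ⟨h₃ | h₃, h₄ | h₄⟩
    · exact absurd (h₃.trans h₄.symm) h₂
    · exact Or.inl ⟨hTU h₃, hTU h₄⟩
    · exact Or.inr ⟨hTU h₃, hTU h₄⟩
    · exact absurd (h₃.trans h₄.symm) h₂
  refine ⟨hsb, (D.side_insert_iff hba').mp ?_, hrel⟩
  rw [← hU] at haU
  rcases hrel with ⟨h₃, h₄⟩ | ⟨h₃, h₄⟩
  · rw [← h₃, ← h₄, haU]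
  · rw [← h₃, ← h₄, haU]

/-- The case where `a` and `b` connect the same two circles: whichever comes first merges them, and
the other one then splits the result. -/
theorem square_of_merge_of_split {S : Finset D.Crossing} {a b : D.Crossing} (ha : a ∉ S)
    (hb : b ∉ S) (hab : a ≠ b) (h₁ : D.side₀ S a ≠ D.side₂ S a)
    (h₂ : D.side₀ (insert b S) a = D.side₂ (insert b S) a) :
    D.side₀ S b ≠ D.side₂ S b ∧ D.side₀ (insert a S) b = D.side₂ (insert a S) b ∧
      ((D.side₀ (insert b (insert a S)) a = D.side₀ (insert b (insert a S)) b ∧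
        D.side₂ (insert b (insert a S)) a = D.side₂ (insert b (insert a S)) b) ∨
      (D.side₀ (insert b (insert a S)) a = D.side₂ (insert b (insert a S)) b ∧
        D.side₂ (insert b (insert a S)) a = D.side₀ (insert b (insert a S)) b)) := by
  have hab' : a ∉ insert b S := by simp [ha, hab]
  have hba' : b ∉ insert a S := by simp [hb, hab.symm]
  have hU : insert b (insert a S) = insert a (insert b S) := Finset.insert_comm b a S
  have hsb : D.side₀ S b ≠ D.side₂ S b := fun h =>
    h₁ ((agreeOff_insert S b).symm.circle_eq h h₂)
  have haT := (D.side_insert_iff ha).mpr h₁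
  have hST := fun {p q} => (agreeOff_insert S a).circle_eq haT (p := p) (q := q)
  have hnear := ((agreeOff_insert S b).symm.circle_eq_or_near h₂).resolve_left h₁
  have hsbT : D.side₀ (insert a S) b = D.side₂ (insert a S) b := by
    rcases hnear with ⟨h₃ | h₃, h₄ | h₄⟩
    · exact absurd (h₃.trans h₄.symm) h₁
    · exact (hST h₃).symm.trans (haT.trans (hST h₄))
    · exact (hST h₄).symm.trans (haT.symm.trans (hST h₃))
    · exact absurd (h₃.trans h₄.symm) h₁
  have hbU : D.side₀ (insert b (insert a S)) b ≠ D.side₂ (insert b (insert a S)) b := fun h =>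
    (D.side_insert_iff hba').mp h hsbT
  have hTU : D.AgreeOff (insert a S) (insert b (insert a S)) b := agreeOff_insert _ b
  have haU : D.side₀ (insert b (insert a S)) a ≠ D.side₂ (insert b (insert a S)) a := fun h => by
    rw [hU] at h
    exact (D.side_insert_iff hab').mp h h₂
  refine ⟨hsb, hsbT, ?_⟩
  obtain ⟨h₃, h₄⟩ := (hTU.circle_eq_or_near (p := Sum.inl (a, 0)) (q := Sum.inl (a, 2))
    haT).resolve_left haU
  rcases h₃ with h₃ | h₃ <;> rcases h₄ with h₄ | h₄
  · exact absurd (h₃.trans h₄.symm) haU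
  · exact Or.inl ⟨h₃, h₄⟩
  · exact Or.inr ⟨h₃, h₄⟩
  · exact absurd (h₃.trans h₄.symm) haU

theorem pt₂_comul_one_eq (F : FrobeniusStructure K A) {U : Finset D.Crossing} {a b : D.Crossing}
    (h : (D.side₀ U a = D.side₀ U b ∧ D.side₂ U a = D.side₂ U b) ∨
      (D.side₀ U a = D.side₂ U b ∧ D.side₂ U a = D.side₀ U b)) :
    pt₂ K U (Sum.inl (a, 0)) (Sum.inl (a, 2)) (F.comul 1) =
      pt₂ K U (Sum.inl (b, 0)) (Sum.inl (b, 2)) (F.comul 1) := by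
  rcases h with ⟨h₁, h₂⟩ | ⟨h₁, h₂⟩
  · exact pt₂_congr h₁ h₂ _
  · rw [← pt₂_comm, F.comm_comul_one]
    exact pt₂_congr h₂ h₁ _

open Classical in
-- Point-linearity of the second map carries the `Δ(1)` created by the first one to the final state
-- unchanged.
theorem edgeMap_edgeMap_one (F : FrobeniusStructure K A) {S : Finset D.Crossing}
    {a b : D.Crossing} (hb : b ∉ insert a S) :
    edgeMap F D (insert a S) (insert b (insert a S)) b (edgeMap F D S (insert a S) a 1) =
      (if D.side₀ S a = D.side₂ S a then
        pt₂ K (insert b (insert a S)) (Sum.inl (a, 0)) (Sum.inl (a, 2)) (F.comul 1) else 1) *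
      (if D.side₀ (insert a S) b = D.side₂ (insert a S) b then
        pt₂ K (insert b (insert a S)) (Sum.inl (b, 0)) (Sum.inl (b, 2)) (F.comul 1) else 1) := by
  have h₁ : edgeMap F D (insert a S) (insert b (insert a S)) b (edgeMap F D S (insert a S) a 1) =
      (if D.side₀ S a = D.side₂ S a then
        pt₂ K (insert b (insert a S)) (Sum.inl (a, 0)) (Sum.inl (a, 2)) (F.comul 1) else 1) *
      edgeMap F D (insert a S) (insert b (insert a S)) b 1 := by
    split_ifs with h
    · rw [edgeMap_one_of_split F h, ← (pointLinear_edgeMap F hb).map_pt₂_mul, mul_one]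
    · rw [edgeMap_one_of_merge F h, one_mul]
  rw [h₁]
  congr 1
  split_ifs with h
  · exact edgeMap_one_of_split F h _
  · exact edgeMap_one_of_merge F h _

theorem cube_isCommutative (D : LinkDiagram) (F : FrobeniusStructure K A) :
    (D.cube F).IsCommutative := by
  intro S Ta Tb U a b ha hb hTa hTb hb' ha' hU hU'
  subst hTa hTb hU
  have hab : a ≠ b := by
    rintro rfl
    exact hb' (Finset.mem_insert_self _ _)
  change ModuleCat.ofHom (edgeMap F D S _ a) ≫ ModuleCat.ofHom (edgeMap F D _ _ b) =
    ModuleCat.ofHom (edgeMap F D S _ b) ≫ ModuleCat.ofHom (edgeMap F D _ _ a)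
  rw [← ModuleCat.ofHom_comp, ← ModuleCat.ofHom_comp]
  congr 1
  have hl := (pointLinear_edgeMap F hb').comp (pointLinear_edgeMap F ha)
  have hr := (pointLinear_edgeMap F ha').comp (pointLinear_edgeMap F hb)
  rw [hU'] at hr
  refine hl.ext hr ?_
  rw [LinearMap.comp_apply, LinearMap.comp_apply, edgeMap_edgeMap_one F hb']
  have h := edgeMap_edgeMap_one F ha'
  rw [hU'] at h
  rw [h]
  -- If neither crossing changes type, the two products have the same factors. Otherwise the square
  -- lemmas either exclude the case or identify the single `Δ(1)` on each side.
  by_cases h₁ : D.side₀ S a = D.side₂ S a <;>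
    by_cases h₂ : D.side₀ (insert b S) a = D.side₂ (insert b S) a <;>
    by_cases h₃ : D.side₀ S b = D.side₂ S b <;>
    by_cases h₄ : D.side₀ (insert a S) b = D.side₂ (insert a S) b <;>
    simp only [h₁, h₂, h₃, h₄, if_true, if_false, one_mul, mul_one, mul_comm]
  all_goals first
    | exact absurd h₄ (square_of_split_of_merge ha hb hab h₁ h₂).2.1
    | exact absurd (square_of_split_of_merge ha hb hab h₁ h₂).1 h₃
    | exact absurd h₃ (square_of_merge_of_split ha hb hab h₁ h₂).1
    | exact absurd (square_of_merge_of_split ha hb hab h₁ h₂).2.1 h₄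
    | exact absurd h₂ (square_of_split_of_merge hb ha hab.symm h₃ h₄).2.1
    | exact absurd (square_of_split_of_merge hb ha hab.symm h₃ h₄).1 h₁
    | exact absurd h₁ (square_of_merge_of_split hb ha hab.symm h₃ h₄).1
    | exact absurd (square_of_merge_of_split hb ha hab.symm h₃ h₄).2.1 h₂
    | exact pt₂_comul_one_eq F (square_of_split_of_merge ha hb hab h₁ h₂).2.2
    | exact (pt₂_comul_one_eq F (square_of_merge_of_split ha hb hab h₁ h₂).2.2).symm

end LinkDiagram

namespace LinkDiagram

variable {D : LinkDiagram}

/-! ### The position of a circle with respect to the base faces -/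

/-- The indicator function of a circle. -/
noncomputable def indicator {S : Finset D.Crossing} (C : D.Circle S) (x : D.Crossing × Fin 4) :
    ZMod 2 :=
  if D.circle S (Sum.inl x) = C then 1 else 0

theorem indicator_edge {S : Finset D.Crossing} (C : D.Circle S) (x : D.Crossing × Fin 4) :
    indicator C (D.edge x) = indicator C x := by
  rw [indicator, circle_edge, indicator]

theorem indicator_smooth {S : Finset D.Crossing} (C : D.Circle S) (x : D.Crossing × Fin 4) :
    indicator C (D.smooth S x) = indicator C x := by
  rw [indicator, circle_smooth, indicator]

/-- A circle passes a crossing along entire arcs, each of which has two ends there. -/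
theorem isCycle_indicator {S : Finset D.Crossing} (C : D.Circle S) : D.IsCycle (indicator C) := by
  refine ⟨indicator_edge C, fun c => ?_⟩
  have h₁ := indicator_smooth C (c, 1)
  have h₃ := indicator_smooth C (c, 3)
  rw [Fin.sum_univ_four]
  have key : ∀ a b : ZMod 2, a + a + b + b = 0 ∧ a + b + b + a = 0 := by decide
  by_cases hc : c ∈ S
  · simp only [smooth, hc] at h₁ h₃
    rw [← show indicator C (c, 2) = indicator C (c, 1) from h₁,
      ← show indicator C (c, 0) = indicator C (c, 3) from h₃]
    exact (key _ _).2
  · simp only [smooth, hc] at h₁ h₃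
    rw [← show indicator C (c, 0) = indicator C (c, 1) from h₁,
      ← show indicator C (c, 2) = indicator C (c, 3) from h₃]
    exact (key _ _).1

theorem IsPotential.smooth {S : Finset D.Crossing} {C : D.Circle S}
    {g : D.Crossing × Fin 4 → ZMod 2} (hg : D.IsPotential (indicator C) g)
    (x : D.Crossing × Fin 4) : g (D.smooth S x) = g x + indicator C x := by
  obtain ⟨c, i⟩ := x
  have back : ∀ i : Fin 4, D.smooth S (c, i + 1) = (c, i) → g (c, i) =
      g (c, i + 1) + indicator C (c, i + 1) := by
    intro i h
    rw [hg.rotate, ← indicator_smooth C (c, i + 1), h, add_assoc, CharTwo.add_self_eq_zero,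
      add_zero]
  have hs : ∀ i : Fin 4, D.smooth S (c, i) = (c, i + 1) ∨ D.smooth S (c, i + 1 + 1 + 1) = (c, i) ∧
      D.smooth S (c, i) = (c, i + 1 + 1 + 1) := by
    intro i
    by_cases hc : c ∈ S <;> fin_cases i <;> simp [LinkDiagram.smooth, hc]
  rcases hs i with h | ⟨h, h'⟩
  · rw [h, hg.rotate]
  · have e : i = i + 1 + 1 + 1 + 1 := by omega
    have h'' : D.smooth S (c, i + 1 + 1 + 1 + 1) = (c, i + 1 + 1 + 1) := by rw [← e, h']
    have := back _ h''
    rw [← e] at this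
    rw [h', this]

/-- A potential of a circle is constant along any other circle. -/
theorem IsPotential.eq_of_circle_eq {S : Finset D.Crossing} {C : D.Circle S}
    {g : D.Crossing × Fin 4 → ZMod 2} (hg : D.IsPotential (indicator C) g)
    {x y : D.Crossing × Fin 4} (h : D.circle S (Sum.inl x) = D.circle S (Sum.inl y))
    (hC : D.circle S (Sum.inl x) ≠ C) : g x = g y := by
  -- Away from `C` the potential does not jump along edges and arcs; it is replaced by `0` on `C` so
  -- as to be constant along every circle.
  let φ : D.Point → ZMod 2 := Sum.elim
    (fun x => if D.circle S (Sum.inl x) = C then 0 else g x) fun _ => 0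
  have hφ : ∀ p q, D.Adj S p q → φ p = φ q := by
    rintro _ _ (z | z)
    · by_cases hz : D.circle S (Sum.inl z) = C
      · simp [φ, circle_edge, hz]
      · simp [φ, circle_edge, hz, hg.edge, indicator]
    · by_cases hz : D.circle S (Sum.inl z) = C
      · simp [φ, circle_smooth, hz]
      · simp [φ, circle_smooth, hz, hg.smooth, indicator]
  have h' : φ (Sum.inl x) = φ (Sum.inl y) := congrArg (Quot.lift φ hφ) h
  simpa only [φ, Sum.elim_inl, if_neg hC, if_neg (h ▸ hC)] using h'

/-- Two circles cannot both separate the other one from the base face. -/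
theorem not_potential_eq_one {S : Finset D.Crossing} {x y : D.Crossing × Fin 4}
    (h : D.circle S (Sum.inl x) ≠ D.circle S (Sum.inl y)) :
    ¬ (D.potential (indicator (D.circle S (Sum.inl y))) x = 1 ∧
      D.potential (indicator (D.circle S (Sum.inl x))) y = 1) := by
  rintro ⟨hx, hy⟩
  have hpx := (isCycle_indicator (D.circle S (Sum.inl x))).isPotential
  have hpy := (isCycle_indicator (D.circle S (Sum.inl y))).isPotential
  have hbx := D.potential_base (indicator (D.circle S (Sum.inl x))) x
  have hby := D.potential_base (indicator (D.circle S (Sum.inl y))) x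
  have h₁ : ∀ z, indicator (D.circle S (Sum.inl x)) z = 1 →
      D.potential (indicator (D.circle S (Sum.inl y))) z = 1 ∧
      indicator (D.circle S (Sum.inl y)) z = 0 := by
    intro z hz
    have hz' : D.circle S (Sum.inl z) = D.circle S (Sum.inl x) := by
      by_contra e
      simp [indicator, e] at hz
    exact ⟨(hpy.eq_of_circle_eq hz' (hz' ▸ h)).trans hx, by simp [indicator, hz', h]⟩
  have h₂ : ∀ z, indicator (D.circle S (Sum.inl y)) z = 1 →
      D.potential (indicator (D.circle S (Sum.inl x))) z = 1 ∧
      indicator (D.circle S (Sum.inl x)) z = 0 := by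
    intro z hz
    have hz' : D.circle S (Sum.inl z) = D.circle S (Sum.inl y) := by
      by_contra e
      simp [indicator, e] at hz
    exact ⟨(hpx.eq_of_circle_eq hz' (hz' ▸ h.symm)).trans hy, by simp [indicator, hz', h.symm]⟩
  generalize D.potential (indicator (D.circle S (Sum.inl x))) = P at *
  generalize D.potential (indicator (D.circle S (Sum.inl y))) = Q at *
  generalize indicator (D.circle S (Sum.inl x)) = u at *
  generalize indicator (D.circle S (Sum.inl y)) = v at *
  -- The product `(1 + P) (1 + Q)` is the indicator of the region on the base side of both circles.
  -- If each circle were beyond the other one, this region would have no boundary, yet it contains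
  -- the base face and not the face at `x`.
  have key : ∀ p q a b : ZMod 2, (a = 1 → q = 1 ∧ b = 0) → (b = 1 → p = 1 ∧ a = 0) →
      (1 + (p + a)) * (1 + (q + b)) = (1 + p) * (1 + q) := by decide
  have := eq_base (g := fun z => (1 + P z) * (1 + Q z))
    (fun z => by
      simp only [hpx.edge, hpy.edge]
      exact key _ _ _ _ (h₁ z) (h₂ z))
    (fun c i => by
      simp only [hpx.rotate, hpy.rotate]
      exact key _ _ _ _ (h₁ _) (h₂ _)) x
  simp only [hbx, hby, hx] at this
  revert this
  generalize P x = p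
  revert p
  decide

/-- The value, on the faces of colour `1` along the circle through a point, of the indicator
function of the side of the circle which does not contain the base face. -/
noncomputable def pointIndex (S : Finset D.Crossing) : D.Point → ℕ :=
  Sum.elim (fun x => (D.potential (indicator (D.circle S (Sum.inl x))) x + D.color x + 1).val)
    fun _ => 0

/-- The index of a circle: it is `1` if the faces of colour `1` along the circle are separated by
it from the base face, and `0` otherwise. -/
noncomputable def circleIndex (S : Finset D.Crossing) : D.Circle S → ℕ :=
  Quot.lift (pointIndex S) (by
    -- Along the circle itself, potential and colour both jump at each edge and each arc.
    have key : ∀ a b : ZMod 2, a + 1 + (b + 1) + 1 = a + b + 1 := by decide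
    rintro _ _ (x | x)
    · simp only [pointIndex, Sum.elim_inl, circle_edge, color_edge,
        (isCycle_indicator _).isPotential.edge, indicator, if_true, key]
    · simp only [pointIndex, Sum.elim_inl, circle_smooth, color_smooth,
        (isCycle_indicator _).isPotential.smooth]
      simp only [indicator, if_true, key])

theorem circleIndex_circle (S : Finset D.Crossing) (p : D.Point) :
    circleIndex S (D.circle S p) = pointIndex S p := rfl

theorem AgreeOff.circle_eq_iff {S T : Finset D.Crossing} {c : D.Crossing}
    (hST : D.AgreeOff S T c) {p : D.Point} (hp : ¬ Near S c p) (q : D.Point) :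
    D.circle S q = D.circle S p ↔ D.circle T q = D.circle T p := by
  constructor
  · intro h
    exact (hST.circle_eq_or_near h).resolve_right fun h' => hp ((hST.near_iff p).mpr h'.2)
  · intro h
    exact (hST.symm.circle_eq_or_near h).resolve_right fun h' => hp h'.2

theorem AgreeOff.circleIndex_eq {S T : Finset D.Crossing} {c : D.Crossing}
    (hST : D.AgreeOff S T c) {p : D.Point} (hp : ¬ Near S c p) :
    circleIndex S (D.circle S p) = circleIndex T (D.circle T p) := by
  rw [circleIndex_circle, circleIndex_circle]
  rcases p with x | _
  · have h : indicator (D.circle S (Sum.inl x)) = indicator (D.circle T (Sum.inl x)) := by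
      ext y
      simp only [indicator, hST.circle_eq_iff hp]
    simp only [pointIndex, Sum.elim_inl, h]
  · simp only [pointIndex, Sum.elim_inr]

/-- The behaviour of indices when two circles merge. -/
theorem AgreeOff.circleIndex_merge {S T : Finset D.Crossing} {c : D.Crossing}
    (hST : D.AgreeOff S T c) (hS : D.side₀ S c ≠ D.side₂ S c) (hT : D.side₀ T c = D.side₂ T c) :
    circleIndex S (D.side₀ S c) + circleIndex S (D.side₂ S c) =
      circleIndex T (D.side₀ T c) + (D.color (c, 0) + 1 + if c ∈ S then 1 else 0).val := by
  -- As a cycle, the merged circle is the sum of the two circles, so potentials add up.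
  have hind : indicator (D.side₀ T c) = indicator (D.side₀ S c) + indicator (D.side₂ S c) := by
    ext x
    have hx := hST.near_iff (Sum.inl x)
    rw [Near, Near, ← hT, or_self] at hx
    simp only [indicator, Pi.add_apply, ← hx]
    by_cases h₀ : D.circle S (Sum.inl x) = D.side₀ S c
    · simp [h₀, hS]
    · simp [h₀]
  have hc₀ := isCycle_indicator (D.side₀ S c)
  have hc₂ := isCycle_indicator (D.side₂ S c)
  have h₁ : D.circle S (Sum.inl (c, 1)) = if c ∈ S then D.side₂ S c else D.side₀ S c := by
    have h := D.circle_smooth S (c, 1)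
    by_cases hc : c ∈ S
    · simp only [smooth, hc] at h
      rw [if_pos hc]
      exact h.symm
    · simp only [smooth, hc] at h
      rw [if_neg hc]
      exact h.symm
  have e₀₁ := hc₀.isPotential.rotate c 0
  have e₁₂ := hc₀.isPotential.rotate c 1
  have f₀₁ := hc₂.isPotential.rotate c 0
  have f₁₂ := hc₂.isPotential.rotate c 1
  have i₀ : indicator (D.side₀ S c) (c, 0) = 1 := if_pos rfl
  have i₁ : indicator (D.side₀ S c) (c, 1) = if c ∈ S then 0 else 1 := by
    rw [indicator, h₁]
    split_ifs <;> simp_all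
  have j₀ : indicator (D.side₂ S c) (c, 0) = 0 := if_neg hS
  have j₁ : indicator (D.side₂ S c) (c, 1) = if c ∈ S then 1 else 0 := by
    rw [indicator, h₁]
    split_ifs <;> simp_all
  have hno := not_potential_eq_one (S := S) (x := (c, 0)) (y := (c, 2)) hS
  have hidx : ∀ (R : Finset D.Crossing) (x : D.Crossing × Fin 4),
      circleIndex R (D.circle R (Sum.inl x)) =
        (D.potential (indicator (D.circle R (Sum.inl x))) x + D.color x + 1).val :=
    fun _ _ => rfl
  have k₀ : circleIndex S (D.side₀ S c) =
      (D.potential (indicator (D.side₀ S c)) (c, 0) + D.color (c, 0) + 1).val := hidx S (c, 0)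
  have k₂ : circleIndex S (D.side₂ S c) =
      (D.potential (indicator (D.side₂ S c)) (c, 2) + D.color (c, 2) + 1).val := hidx S (c, 2)
  have kT : circleIndex T (D.side₀ T c) =
      (D.potential (indicator (D.side₀ T c)) (c, 0) + D.color (c, 0) + 1).val := hidx T (c, 0)
  rw [hind, hc₀.potential_add hc₂] at kT
  rw [k₀, k₂, kT, color_two]
  change ¬ (D.potential (indicator (D.side₂ S c)) (c, 0) = 1 ∧
      D.potential (indicator (D.side₀ S c)) (c, 2) = 1) at hno
  change D.potential _ (c, 1) = _ at e₀₁ f₀₁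
  change D.potential _ (c, 2) = _ at e₁₂ f₁₂
  rw [e₁₂, e₀₁, i₀, i₁] at hno
  rw [f₁₂, f₀₁, j₀, j₁]
  generalize D.potential (indicator (D.side₀ S c)) (c, 0) = p at *
  generalize D.potential (indicator (D.side₂ S c)) (c, 0) = q at *
  generalize D.color (c, 0) = o at *
  -- The identity now holds modulo two without further input; `hno`, which rules out that each
  -- circle is beyond the other, makes it an identity of natural numbers.
  clear * - hno
  by_cases hc : c ∈ S
  · simp only [hc, if_true] at hno ⊢
    revert hno o q p
    decide
  · simp only [hc, if_false] at hno ⊢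
    revert hno o q p
    decide

end LinkDiagram

namespace LinkDiagram

variable {K A : Type*} [CommRing K] [CommRing A] [Algebra K A] {D : LinkDiagram}

/-! ### Merging circles -/

variable (K A) in
/-- The algebra map between state modules which merges circles. -/
noncomputable def merge (S T : Finset D.Crossing) : StateModule K A D S →ₐ[K] StateModule K A D T :=
  PiTensorProduct.liftAlgHom
    ((MultilinearMap.mkPiAlgebra K (D.Circle S) (StateModule K A D T)).compLinearMap
      fun C => (incl K A D (D.corr T C)).toLinearMap)
    (by simp) (fun v w => by simp [Finset.prod_mul_distrib])

theorem AgreeOff.merge_pt {S T : Finset D.Crossing} {c : D.Crossing} (hST : D.AgreeOff S T c)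
    (hT : D.side₀ T c = D.side₂ T c) (p : D.Point) (a : A) :
    merge K A S T (pt K S p a) = pt K T p a := by
  have h₁ : merge K A S T (pt K S p a) =
      ∏ C, incl K A D (D.corr T C) (Pi.mulSingle (M := fun _ => A) (D.circle S p) a C) := by
    change PiTensorProduct.lift _ (PiTensorProduct.tprod K _) = _
    rw [PiTensorProduct.lift.tprod, MultilinearMap.compLinearMap_apply,
      MultilinearMap.mkPiAlgebra_apply]
    rfl
  have h₂ : D.corr T (D.circle S p) = D.circle T p :=
    hST.circle_eq hT (circle_out (D.circle S p))
  rw [h₁, Finset.prod_eq_single (D.circle S p), Pi.mulSingle_eq_same, h₂, pt]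
  · intro C _ hC
    rw [Pi.mulSingle_eq_of_ne hC, map_one]
  · exact fun h => absurd (Finset.mem_univ _) h

theorem AgreeOff.pointLinear_merge {S T : Finset D.Crossing} {c : D.Crossing}
    (hST : D.AgreeOff S T c) (hT : D.side₀ T c = D.side₂ T c) :
    PointLinear (merge K A S T).toLinearMap := fun p a x => by
  rw [AlgHom.toLinearMap_apply, map_mul, hST.merge_pt hT, AlgHom.toLinearMap_apply]

/-- A product over the circles before a merger, as a product over the circles after it. -/
theorem AgreeOff.prod_circle {S T : Finset D.Crossing} {c : D.Crossing} (hST : D.AgreeOff S T c)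
    (hS : D.side₀ S c ≠ D.side₂ S c) (hT : D.side₀ T c = D.side₂ T c)
    {M : Type*} [CommMonoid M] (g : D.Circle S → M) (h : D.Circle T → M) (m : M)
    (hfar : ∀ p, ¬ Near S c p → g (D.circle S p) = h (D.circle T p))
    (hnear : g (D.side₀ S c) * g (D.side₂ S c) = m * h (D.side₀ T c)) :
    ∏ C, g C = m * ∏ C, h C := by
  -- The fibre of `corr T` over the merged circle consists of the two sides of `c`; all other fibres
  -- are single circles.
  rw [← prod_incl_mul h (D.side₀ T c), ← Finset.prod_fiberwise Finset.univ (D.corr T)]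
  refine Finset.prod_congr rfl fun C' _ => ?_
  have hcorr : ∀ p, D.corr T (D.circle S p) = D.circle T p := fun p =>
    hST.circle_eq hT (circle_out (D.circle S p))
  split_ifs with hC'
  · subst hC'
    have : Finset.univ.filter (fun C => D.corr T C = D.side₀ T c) =
        {D.side₀ S c, D.side₂ S c} := by
      ext C
      have hC := hST.near_iff (Quot.out C)
      rw [Near, Near, ← hT, or_self, circle_out] at hC
      simp only [Finset.mem_filter, Finset.mem_univ, true_and, Finset.mem_insert,
        Finset.mem_singleton, hC]
      rfl
    rw [this, Finset.prod_pair hS, hnear]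
  · have hq : ¬ Near S c (Quot.out C') := by
      rw [hST.near_iff, Near, ← hT, or_self, circle_out]
      exact hC'
    have : Finset.univ.filter (fun C => D.corr T C = C') = {D.circle S (Quot.out C')} := by
      ext C
      have hC := hST.circle_eq_iff hq (Quot.out C)
      rw [circle_out, circle_out] at hC
      simp only [Finset.mem_filter, Finset.mem_univ, true_and, Finset.mem_singleton, hC]
      rfl
    rw [this, Finset.prod_singleton, hfar _ hq, circle_out, one_mul]

/-! ### The isomorphism -/

variable (K) in
/-- The product of the powers of `θ`, in the factors of all circles, given by their indices. -/
noncomputable def indexUnit (θ : Aˣ) (S : Finset D.Crossing) : (StateModule K A D S)ˣ :=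
  ∏ C : D.Circle S, Units.map (incl K A D C : A →* StateModule K A D S) θ ^ circleIndex S C

variable (K) in
/-- The invertible element of the state module by which the isomorphism multiplies. -/
noncomputable def stateUnit (θ : Aˣ) (S : Finset D.Crossing) : (StateModule K A D S)ˣ :=
  (∏ c ∈ S, Units.map ((pt K S (Sum.inl (c, 0)) : A →ₐ[K] StateModule K A D S) : A →* _) θ ^
    (D.color (c, 0) + 1).val) * indexUnit K θ S

theorem coe_indexUnit (θ : Aˣ) (S : Finset D.Crossing) :
    (indexUnit K θ S : StateModule K A D S) =
      ∏ C : D.Circle S, incl K A D C (θ : A) ^ circleIndex S C := by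
  simp [indexUnit, Units.coe_prod]

theorem coe_stateUnit (θ : Aˣ) (S : Finset D.Crossing) :
    (stateUnit K θ S : StateModule K A D S) =
      (∏ c ∈ S, pt K S (Sum.inl (c, 0)) (θ : A) ^ (D.color (c, 0) + 1).val) *
        indexUnit K θ S := by
  simp [stateUnit, Units.coe_prod]

/-- The multiplicative form of `AgreeOff.circleIndex_merge`. The surplus power at `c` is what the
crossing factors of `stateUnit` compensate. -/
theorem AgreeOff.merge_indexUnit {S T : Finset D.Crossing} {c : D.Crossing}
    (hST : D.AgreeOff S T c) (hS : D.side₀ S c ≠ D.side₂ S c) (hT : D.side₀ T c = D.side₂ T c)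
    (θ : Aˣ) :
    merge K A S T (indexUnit K θ S) = pt K T (Sum.inl (c, 0)) (θ : A) ^
      (D.color (c, 0) + 1 + if c ∈ S then 1 else 0).val * indexUnit K θ T := by
  rw [coe_indexUnit, coe_indexUnit, map_prod]
  refine hST.prod_circle hS hT _ _ _ (fun p hp => ?_) ?_
  · rw [hST.circleIndex_eq hp, map_pow]
    congr 1
    exact hST.merge_pt hT p _
  · have h₀ : merge K A S T (incl K A D (D.side₀ S c) (θ : A)) = pt K T (Sum.inl (c, 0)) (θ : A) :=
      hST.merge_pt hT _ _
    have h₂ : merge K A S T (incl K A D (D.side₂ S c) (θ : A)) = pt K T (Sum.inl (c, 0)) (θ : A) :=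
      (hST.merge_pt hT (Sum.inl (c, 2)) _).trans (by rw [pt_congr hT.symm])
    have hT₀ : incl K A D (D.side₀ T c) (θ : A) = pt K T (Sum.inl (c, 0)) (θ : A) := rfl
    rw [map_pow, map_pow, h₀, h₂, hT₀, ← pow_add, ← pow_add, hST.circleIndex_merge hS hT, add_comm]

/-! ### Structure maps and the state units -/

theorem edgeMap_eq_merge (F : FrobeniusStructure K A) {S : Finset D.Crossing} {c : D.Crossing}
    (hc : c ∉ S) (h : D.side₀ S c ≠ D.side₂ S c) :
    edgeMap F D S (insert c S) c = (merge K A S (insert c S)).toLinearMap := by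
  refine (pointLinear_edgeMap F hc).ext
    ((agreeOff_insert S c).pointLinear_merge ((D.side_insert_iff hc).mpr h)) ?_
  rw [edgeMap_one_of_merge F h, AlgHom.toLinearMap_apply, map_one]

/-- Both sides are point-linear in `y` and agree at `1`. This evaluates a split on any element
presented as the merger of an element of the larger state. -/
theorem edgeMap_merge (F : FrobeniusStructure K A) {S : Finset D.Crossing} {c : D.Crossing}
    (hc : c ∉ S) (h : D.side₀ S c = D.side₂ S c) (y : StateModule K A D (insert c S)) :
    edgeMap F D S (insert c S) c (merge K A (insert c S) S y) =
      edgeMap F D S (insert c S) c 1 * y := by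
  have hl := (pointLinear_edgeMap F hc).comp
    ((agreeOff_insert S c).symm.pointLinear_merge (K := K) (A := A) h)
  have hr : PointLinear (LinearMap.mulLeft K (edgeMap F D S (insert c S) c 1)) := fun p a x => by
    rw [LinearMap.mulLeft_apply, LinearMap.mulLeft_apply, mul_left_comm]
  have := hl.ext hr (by simp)
  exact LinearMap.congr_fun this y

theorem edgeMap_stateUnit (F : FrobeniusStructure K A) (θ : Aˣ) {S : Finset D.Crossing}
    {c : D.Crossing} (hc : c ∉ S) :
    edgeMap F D S (insert c S) c (stateUnit K θ S) =
      stateUnit K θ (insert c S) * edgeMap (F.twist θ) D S (insert c S) c 1 := by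
  by_cases h : D.side₀ S c = D.side₂ S c
  · have hST := (agreeOff_insert S c).symm
    have hT : D.side₀ (insert c S) c ≠ D.side₂ (insert c S) c := fun h' =>
      (D.side_insert_iff hc).mp h' h
    have h₁ : edgeMap (F.twist θ) D S (insert c S) c 1 =
        pt K (insert c S) (Sum.inl (c, 0)) ((θ⁻¹ : Aˣ) : A) * edgeMap F D S (insert c S) c 1 := by
      rw [edgeMap_one_of_split _ h, edgeMap_one_of_split _ h]
      change pt₂ K _ _ _ (F.comul (((θ⁻¹ : Aˣ) : A) * 1)) = _
      rw [F.comul_mul_left, map_mul, pt₂, Algebra.TensorProduct.lift_tmul, map_one, mul_one]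
    have h₂ : merge K A (insert c S) S (stateUnit K θ (insert c S)) =
        pt K S (Sum.inl (c, 0)) (θ : A) * stateUnit K θ S := by
      -- The crossing factor at `c` and the surplus of the merger have complementary exponents, so
      -- exactly one `θ` remains for either colour.
      have key : ∀ o : ZMod 2, (o + 1).val + (o + 1 + 1).val = 1 := by decide
      rw [coe_stateUnit, coe_stateUnit, map_mul, hST.merge_indexUnit hT h, map_prod,
        Finset.prod_insert hc, if_pos (Finset.mem_insert_self _ _)]
      simp only [map_pow, hST.merge_pt h]
      conv_rhs => rw [← pow_one (pt K S (Sum.inl (c, 0)) (θ : A)), ← key (D.color (c, 0)), pow_add]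
      ring
    have h₃ : (stateUnit K θ S : StateModule K A D S) = merge K A (insert c S) S
        (pt K (insert c S) (Sum.inl (c, 0)) ((θ⁻¹ : Aˣ) : A) * stateUnit K θ (insert c S)) := by
      rw [map_mul, h₂, hST.merge_pt h, ← mul_assoc, ← map_mul, Units.inv_mul, map_one, one_mul]
    rw [h₁, h₃, edgeMap_merge F hc h]
    ring
  · have hST := agreeOff_insert S c
    have hT := (D.side_insert_iff hc).mpr h
    rw [edgeMap_one_of_merge _ h, mul_one, edgeMap_eq_merge F hc h, AlgHom.toLinearMap_apply,
      coe_stateUnit, coe_stateUnit, map_mul, hST.merge_indexUnit h hT, map_prod,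
      Finset.prod_insert hc, if_neg hc, add_zero]
    simp only [map_pow, hST.merge_pt hT]
    ring

/-- Both sides are point-linear in `x`, so `edgeMap_stateUnit`, the case `x = 1`, suffices. -/
theorem stateUnit_mul_edgeMap (F : FrobeniusStructure K A) (θ : Aˣ) {S : Finset D.Crossing}
    {c : D.Crossing} (hc : c ∉ S) (x : StateModule K A D S) :
    stateUnit K θ (insert c S) * edgeMap (F.twist θ) D S (insert c S) c x =
      edgeMap F D S (insert c S) c (stateUnit K θ S * x) := by
  have := ((pointLinear_edgeMap (F.twist θ) hc).mulLeft (stateUnit K θ (insert c S))).ext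
    ((pointLinear_edgeMap F hc).comp_mulLeft (stateUnit K θ S)) (by
      rw [LinearMap.comp_apply, LinearMap.comp_apply, LinearMap.mulLeft_apply,
        LinearMap.mulLeft_apply, mul_one, edgeMap_stateUnit F θ hc])
  exact LinearMap.congr_fun this x

/-- The isomorphism between the cubes of a Frobenius algebra and its twist. -/
noncomputable def twistIso (F : FrobeniusStructure K A) (θ : Aˣ) (D : LinkDiagram) :
    Cube.Iso (D.cube (F.twist θ)) (D.cube F) where
  app S := ((stateUnit K θ S).mulLeftLinearEquiv K (StateModule K A D S)).toModuleIso
  naturality {S T} c hc hT := by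
    subst hT
    ext x
    exact stateUnit_mul_edgeMap F θ hc x

end LinkDiagram

/-! ### Isomorphic cubes have isomorphic complexes -/

namespace Cube

variable {Λ : Type*} [Fintype Λ] [DecidableEq Λ] {𝒞 : Type*} [Category 𝒞] [Preadditive 𝒞]
  [HasFiniteBiproducts 𝒞]

theorem diff_π (V : Cube Λ 𝒞) (s : SignAssignment Λ) (i : ℕ)
    (T : {T : Finset Λ // T.card = i + 1}) :
    V.diff s i ≫ biproduct.π (fun S : {S : Finset Λ // S.card = i + 1} => V.obj S.1) T =
      ∑ c : {c : Λ // c ∈ T.1}, ((s.sign (T.1.erase c.1) c.1 : ℤˣ) : ℤ) •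
        (biproduct.π (fun S : {S : Finset Λ // S.card = i} => V.obj S.1)
            ⟨T.1.erase c.1, by rw [Finset.card_erase_of_mem c.2, T.2, Nat.add_sub_cancel]⟩ ≫
          V.map c.1 (Finset.notMem_erase c.1 T.1) (Finset.insert_erase c.2)) :=
  biproduct.lift_π _ T

/-- The isomorphism of cochains given by an isomorphism of cubes. -/
noncomputable def Iso.cochainIso {V W : Cube Λ 𝒞} (e : Iso V W) (i : ℕ) :
    V.cochain i ≅ W.cochain i :=
  biproduct.mapIso fun S : {S : Finset Λ // S.card = i} => e.app S.1

theorem Iso.cochainIso_hom_π {V W : Cube Λ 𝒞} (e : Iso V W) (i : ℕ)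
    (S : {S : Finset Λ // S.card = i}) :
    (e.cochainIso i).hom ≫ biproduct.π (fun S : {S : Finset Λ // S.card = i} => W.obj S.1) S =
      biproduct.π (fun S : {S : Finset Λ // S.card = i} => V.obj S.1) S ≫ (e.app S.1).hom :=
  biproduct.map_π (fun S : {S : Finset Λ // S.card = i} => (e.app S.1).hom) S

theorem Iso.cochainIso_hom_diff {V W : Cube Λ 𝒞} (e : Iso V W) (s : SignAssignment Λ) (i : ℕ) :
    (e.cochainIso i).hom ≫ W.diff s i = V.diff s i ≫ (e.cochainIso (i + 1)).hom := by
  refine biproduct.hom_ext _ _ fun T => ?_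
  rw [Category.assoc, Category.assoc, cochainIso_hom_π, diff_π, ← Category.assoc, diff_π,
    Preadditive.comp_sum, Preadditive.sum_comp]
  refine Finset.sum_congr rfl fun c _ => ?_
  rw [Preadditive.comp_zsmul, Preadditive.zsmul_comp, Category.assoc, e.naturality,
    ← Category.assoc, cochainIso_hom_π, Category.assoc]

/-- The isomorphism of complexes given by an isomorphism of cubes. -/
noncomputable def Iso.complexIso {V W : Cube Λ 𝒞} (e : Iso V W) (hV : V.IsCommutative)
    (hW : W.IsCommutative) (s : SignAssignment Λ) : V.complex hV s ≅ W.complex hW s :=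
  HomologicalComplex.Hom.isoOfComponents e.cochainIso (by
    rintro i _ rfl
    have hVd : (V.complex hV s).d i (i + 1) = V.diff s i := CochainComplex.of_d _ _ _
    have hWd : (W.complex hW s).d i (i + 1) = W.diff s i := CochainComplex.of_d _ _ _
    rw [hVd, hWd]
    exact e.cochainIso_hom_diff s i)

end Cube

theorem mainTheorem2 {K A : Type*} [CommRing K] [CommRing A] [Algebra K A]
    (F : FrobeniusStructure K A) (θ : Aˣ) (D : LinkDiagram) :
    ∃ (hθ : (D.cube (F.twist θ)).IsCommutative) (h : (D.cube F).IsCommutative),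
      Nonempty (Cube.Iso (D.cube (F.twist θ)) (D.cube F)) ∧
      ∀ s : SignAssignment D.Crossing,
        Nonempty ((D.cube (F.twist θ)).complex hθ s ≅ (D.cube F).complex h s) :=
  ⟨D.cube_isCommutative _, D.cube_isCommutative _, ⟨D.twistIso F θ⟩,
    fun s => ⟨(D.twistIso F θ).complexIso _ _ s⟩⟩
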